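/- **Setting.** A capacitated network $\mathcal N=(\nu,\epsilon,\mu,c,\mathcal A,S,R)$ is a finite directed acyclic multigraph with node set $\nu$, edge set $\epsilon$, message set $\mu$, positive integer edge capacities $c$, an alphabet $\mathcal A$, and maps $S,R:\nu\to 2^{\mu}$ giving the messages generated and demanded at each node. It is assumed non-degenerate (every demand is reachable by a path from a node generating the message, and no node both generates and demands the same message), and every message is demanded by some node. Fix a finite field $F$ with $|F|\ge|\mathcal A|$. A weight vector of $\mathcal N$ is a $w\in\{0,1\}^{|\mu|}$ such that, when only the messages $m_i$ with $w_i=1$ are considered and all edges have unit capacity, there is a scalar-linear network code solution over $F$ (a partial scalar-linear solution); $k'$ is the number of weight vectors. A fractional network code with source dimensions $k_i\ge 1$ and edge dimension $n\ge 1$ sends $k_i$ symbols of $F$ for the message $m_i$ and $n\,c(e)$ symbols over the edge $e$; a simple fractional linear solution is such a code that is a linear solution and an aggregate of partial scalar-linear solutions, which occupy disjoint coordinates. The semi-network linear coding capacity region $\mathcal C'_l\subset\mathbb R_+^{|\mu|}$ is the closure of the set of all vectors $(k_1/n,\dots,k_{|\mu|}/n)$ of simple fractional linear solutions. For $\hat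 q\in\mathbb R_+^{|\mu|}$, $\hat q\ne 0$, let $\lambda_{\max}=\max\{\lambda:\lambda\hat q\in\mathcal C'_l\}$. **Oracles.** $\mathcal O_{SLinear}$ solves the following problem exactly: given $w\in\{0,1\}^{|\mu|}$ and edge lengths $l:\epsilon\to\mathbb R_+$, find the set of edges used by a partial scalar-linear solution for $w$ of minimum total length of the used edges, or report that there is none. $\mathcal O_{FCover}$ solves within a factor $B\ge 1$ the problem $\min\{c^{T}x: Ax\ge b,\ 0\le x\le u\}$, where $A$ is a $|\mu|\times k'$ nonnegative integer matrix, $b$ a nonnegative vector, $c$ a positive vector and $u$ a nonnegative integer vector, or reports that it is infeasible. One call takes time $T_{SLinear}$ and $T_{FCover}$ respectively, where these times are at least the numbers of entries of the query, that is, $T_{SLinear}\ge|\mu|+|\epsilon|$ and $T_{FCover}\ge|\mu|k'+|\mu|+2k'$. **Theorem.** There are a single oracle program (for a random access machine with exact unit-cost real arithmetic) and an absolute constant $K$ such that, for all $F$, $\mathcal N$, $B\ge1$ and oracles as above and all $0<\omega\le 1$ and $0\neq\hat q\in\mathbb R_+^{|\mu|}$, the following holds. Given $\mathcal N$, the list of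 its weight vectors (in any order), $\omega$, $B$ and $\hat q$, the program halts with a point $\hat r$ such that $\lambda_{\max}$ exists and $\lambda_{\max}\hat q$ lies on the line segment between $\hat r$ and $(1+\omega)B\,\hat r$, after time at most $$K\,\omega^{-2}\,(\log|\mu|+|\epsilon|)\,B\,\log(|\epsilon|+1)\,\bigl(T_{FCover}+k'\,T_{SLinear}\bigr).$$ -/

import Mathlib

/-! Capacitated networks and fractional network codes. -/

/-- A capacitated network: a finite directed acyclic multigraph on the nodes `Fin numV` with edges
`Fin numE` and messages `Fin numM`, positive integer edge capacities, an alphabet, and for each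
node the set of messages it generates (`src`) and the set of messages it demands (`rcv`). -/
structure CapNetwork where
  numV : ℕ
  numE : ℕ
  numM : ℕ
  tail : Fin numE → Fin numV
  head : Fin numE → Fin numV
  cap : Fin numE → ℕ
  cap_pos : ∀ e, 0 < cap e
  Alph : Type
  alph_finite : Finite Alph
  src : Fin numV → Finset (Fin numM)
  rcv : Fin numV → Finset (Fin numM)
  acyclic : ∀ v, ¬ Relation.TransGen (fun x y => ∃ e, tail e = x ∧ head e = y) v v

namespace CapNetwork

/-- There is an edge from `x` to `y`. -/
def Adj (N : CapNetwork) (x y : Fin N.numV) : Prop := ∃ e, N.tail e = x ∧ N.head e = y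

/-- Non-degenerate network: each demand is reachable from a node generating the message, and no
node both generates and demands the same message. -/
def Nondegenerate (N : CapNetwork) : Prop :=
  (∀ x, ∀ m ∈ N.rcv x, ∃ y, m ∈ N.src y ∧ Relation.ReflTransGen N.Adj y x) ∧
    ∀ x, Disjoint (N.src x) (N.rcv x)

/-- What node `x` sees when message `m` is a vector of `d m` symbols and edge `e` carries `b e`
symbols: the messages generated at `x` and the symbols on the in-edges of `x`. -/
abbrev NodeInput (N : CapNetwork) (F : Type*) (d : Fin N.numM → ℕ) (b : Fin N.numE → ℕ)
    (x : Fin N.numV) :=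
  ((m : {m // m ∈ N.src x}) → Fin (d m) → F) × ((e : {e // N.head e = x}) → Fin (b e) → F)

/-- A network code with message dimensions `d` and edge dimensions `b`: an edge function for every
edge and a decoding function for every demand. -/
structure Code (N : CapNetwork) (F : Type*) (d : Fin N.numM → ℕ) (b : Fin N.numE → ℕ) where
  edgeFun : ∀ e, N.NodeInput F d b (N.tail e) → (Fin (b e) → F)
  decFun : ∀ x, ∀ m : {m // m ∈ N.rcv x}, N.NodeInput F d b x → (Fin (d m) → F)

/-- The input of node `x` when the messages are `a` and the edges carry `s`. -/
def view (N : CapNetwork) {F : Type*} {d : Fin N.numM → ℕ} {b : Fin N.numE → ℕ}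
    (a : ∀ m, Fin (d m) → F) (s : ∀ e, Fin (b e) → F) (x : Fin N.numV) : N.NodeInput F d b x :=
  (fun m => a m, fun e => s e)

namespace Code

variable {N : CapNetwork} {F : Type*} {d : Fin N.numM → ℕ} {b : Fin N.numE → ℕ}

/-- Under the message assignment `a` the edges carry the symbols `s`
(`s` exists and is unique, as the network is acyclic). -/
def Carries (P : N.Code F d b) (a : ∀ m, Fin (d m) → F) (s : ∀ e, Fin (b e) → F) : Prop :=
  ∀ e, s e = P.edgeFun e (N.view a s (N.tail e))

/-- Every demand is satisfied under every message assignment. -/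
def IsSolution (P : N.Code F d b) : Prop :=
  ∀ a s, P.Carries a s → ∀ x, ∀ m : {m // m ∈ N.rcv x}, P.decFun x m (N.view a s x) = a m

/-- All edge functions and decoding functions are linear over `F`. -/
def IsLinear [Field F] (P : N.Code F d b) : Prop :=
  (∀ e, IsLinearMap F (P.edgeFun e)) ∧ ∀ x m, IsLinearMap F (P.decFun x m)

open Classical in
/-- The edges used by a code: those whose edge function is not identically zero. -/
noncomputable def usedEdges [Field F] (P : N.Code F d b) : Finset (Fin N.numE) :=
  Finset.univ.filter fun e => ∃ z, P.edgeFun e z ≠ 0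

end Code

/-- A scalar code for the messages `m` with `w m = 1` only: these have one symbol, the other
messages have none, and every edge has unit capacity. -/
abbrev ScalarCode (N : CapNetwork) (F : Type*) (w : Fin N.numM → Bool) :=
  N.Code F (fun m => (w m).toNat) (fun _ => 1)

/-- A partial scalar-linear network code solution. -/
def IsPartialSolution (N : CapNetwork) (F : Type*) [Field F] {w : Fin N.numM → Bool}
    (P : N.ScalarCode F w) : Prop := P.IsLinear ∧ P.IsSolution

/-- The weight vectors associated with the network (over the field `F`). -/
def IsWeightVector (N : CapNetwork) (F : Type*) [Field F] (w : Fin N.numM → Bool) : Prop :=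
  ∃ P : N.ScalarCode F w, N.IsPartialSolution F P

/-- The total number of weight vectors. -/
noncomputable def numWeights (N : CapNetwork) (F : Type*) [Field F] : ℕ :=
  Nat.card {w // N.IsWeightVector F w}

/-- A fractional network code with source dimension vector `k` and edge dimension `n`. -/
abbrev FracCode (N : CapNetwork) (F : Type*) (k : Fin N.numM → ℕ) (n : ℕ) :=
  N.Code F k (fun e => n * N.cap e)

theorem eq_true_of_fin_toNat {v : Bool} (i : Fin v.toNat) : v = true := by
  cases v
  · exact i.elim0
  · rfl

/-- A presentation of a fractional code `C` as an aggregate of partial scalar-linear solutions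
`P t`. Each coordinate of a message belongs to exactly one of the `P t` that consider this message;
each `P t` has a coordinate of its own on every edge that it uses, and on these coordinates `C`
computes what `P t` computes; all other edge coordinates are inactive. -/
structure Aggregation (N : CapNetwork) (F : Type*) [Field F] {k : Fin N.numM → ℕ} {n : ℕ}
    (C : N.FracCode F k n) where
  T : ℕ
  w : Fin T → Fin N.numM → Bool
  P : ∀ t, N.ScalarCode F (w t)
  sol : ∀ t, N.IsPartialSolution F (P t)
  mslot : ∀ m, {t // w t m = true} ≃ Fin (k m)
  eslot : ∀ e, {t // e ∈ (P t).usedEdges} ↪ Fin (n * N.cap e)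
  /-- The part of a node's input that belongs to `P t`. -/
  part : ∀ t x, N.NodeInput F k (fun e => n * N.cap e) x →
    N.NodeInput F (fun m => (w t m).toNat) (fun _ => 1) x
  part_msg : ∀ t x z m i, (part t x z).1 m i = z.1 m (mslot m ⟨t, eq_true_of_fin_toNat i⟩)
  part_edge : ∀ t x z e i, (part t x z).2 e i =
    if h : e.1 ∈ (P t).usedEdges then z.2 e (eslot e ⟨t, h⟩) else 0
  edge_eq : ∀ e, ∀ t : {t // e ∈ (P t).usedEdges}, ∀ z,
    C.edgeFun e z (eslot e t) = (P t).edgeFun e (part t (N.tail e) z) 0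
  edge_zero : ∀ e j, (∀ t, eslot e t ≠ j) → ∀ z, C.edgeFun e z j = 0
  dec_eq : ∀ x, ∀ m : {m // m ∈ N.rcv x}, ∀ t, ∀ i : Fin (w t m).toNat, ∀ z,
    C.decFun x m z (mslot m ⟨t, eq_true_of_fin_toNat i⟩) = (P t).decFun x m (part t x z) i

/-- Simple fractional linear network code solutions. -/
def IsSimpleSolution (N : CapNetwork) (F : Type*) [Field F] {k : Fin N.numM → ℕ} {n : ℕ}
    (C : N.FracCode F k n) : Prop :=
  C.IsLinear ∧ C.IsSolution ∧ Nonempty (N.Aggregation F C)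

/-- Coding rate vectors achievable by simple fractional linear network code solutions. -/
def simpleRates (N : CapNetwork) (F : Type*) [Field F] : Set (Fin N.numM → ℝ) :=
  {r | ∃ (k : Fin N.numM → ℕ) (n : ℕ), (∀ m, 0 < k m) ∧ 0 < n ∧
    (∃ C : N.FracCode F k n, N.IsSimpleSolution F C) ∧ r = fun m => (k m : ℝ) / n}

/-- The semi-network linear coding capacity region. -/
def semiRegion (N : CapNetwork) (F : Type*) [Field F] : Set (Fin N.numM → ℝ) :=
  closure (N.simpleRates F)

/-- `O` solves the minimum cost scalar-linear network code problem exactly: for messages selected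
by `w` and nonnegative lengths `l` it answers with the edges used by a solution of minimum cost,
or reports that there is no solution. -/
def IsExactCodeOracle (N : CapNetwork) (F : Type*) [Field F]
    (O : (Fin N.numM → Bool) → (Fin N.numE → ℝ) → Option (Finset (Fin N.numE))) : Prop :=
  ∀ w l, (∀ e, 0 ≤ l e) →
    match O w l with
    | some U => ∃ P : N.ScalarCode F w, N.IsPartialSolution F P ∧ U = P.usedEdges ∧
        ∀ P' : N.ScalarCode F w, N.IsPartialSolution F P' →
          ∑ e ∈ U, l e ≤ ∑ e ∈ P'.usedEdges, l e
    | none => ¬ N.IsWeightVector F w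

end CapNetwork

/-! Fractional covering with box constraints. -/

/-- Minimize `c x` subject to `A x ≥ b`, `0 ≤ x ≤ u`. -/
structure CoverInstance (n m : ℕ) where
  A : Matrix (Fin n) (Fin m) ℕ
  b : Fin n → ℝ
  c : Fin m → ℝ
  u : Fin m → ℕ

namespace CoverInstance

variable {n m : ℕ}

def Admissible (I : CoverInstance n m) : Prop := (∀ i, 0 ≤ I.b i) ∧ ∀ j, 0 < I.c j

def Feasible (I : CoverInstance n m) (x : Fin m → ℝ) : Prop :=
  (∀ i, I.b i ≤ ∑ j, (I.A i j : ℝ) * x j) ∧ ∀ j, 0 ≤ x j ∧ x j ≤ I.u j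

def cost (I : CoverInstance n m) (x : Fin m → ℝ) : ℝ := ∑ j, I.c j * x j

/-- `O` solves fractional covering within the approximation guarantee `B`. -/
def IsApproxOracle (B : ℝ) (O : CoverInstance n m → Option (Fin m → ℝ)) : Prop :=
  ∀ I, I.Admissible →
    match O I with
    | some x => I.Feasible x ∧ ∀ y, I.Feasible y → I.cost x ≤ B * I.cost y
    | none => ∀ y, ¬ I.Feasible y

end CoverInstance

/-! A random access machine over the reals with oracles: a memory of natural numbers and a memory
of real numbers, both organized as arrays with two indices, exact arithmetic (without rounding from
reals to integers), and a structured programming language. One program serves inputs of all sizes.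
-/

namespace OracleRAM

/-- `nat a i j` and `real a i j` are the entries with indices `i`, `j` of the `a`-th arrays. -/
structure Mem where
  nat : ℕ → ℕ → ℕ → ℕ
  real : ℕ → ℕ → ℕ → ℝ

/-- Replace the entry `i`, `j` of the `a`-th array. -/
def put {α : Type*} (f : ℕ → ℕ → ℕ → α) (a i j : ℕ) (v : α) : ℕ → ℕ → ℕ → α :=
  fun a' i' j' => if a' = a ∧ i' = i ∧ j' = j then v else f a' i' j'

/-- Expressions for natural numbers. -/
inductive NExp where
  | lit (n : ℕ)
  | cell (a : ℕ) (i j : NExp)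
  | add (x y : NExp)
  | sub (x y : NExp)

/-- Expressions for real numbers. -/
inductive RExp where
  | ofNat (x : NExp)
  | cell (a : ℕ) (i j : NExp)
  | add (x y : RExp)
  | sub (x y : RExp)
  | mul (x y : RExp)
  | div (x y : RExp)

inductive Test where
  | natLt (x y : NExp)
  | natEq (x y : NExp)
  | realLt (x y : RExp)
  | realLe (x y : RExp)

def NExp.eval (s : Mem) : NExp → ℕ
  | .lit n => n
  | .cell a i j => s.nat a (i.eval s) (j.eval s)
  | .add x y => x.eval s + y.eval s
  | .sub x y => x.eval s - y.eval s

noncomputable def RExp.eval (s : Mem) : RExp → ℝ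
  | .ofNat x => (x.eval s : ℝ)
  | .cell a i j => s.real a (i.eval s) (j.eval s)
  | .add x y => x.eval s + y.eval s
  | .sub x y => x.eval s - y.eval s
  | .mul x y => x.eval s * y.eval s
  | .div x y => x.eval s / y.eval s

def Test.holds (s : Mem) : Test → Prop
  | .natLt x y => x.eval s < y.eval s
  | .natEq x y => x.eval s = y.eval s
  | .realLt x y => x.eval s < y.eval s
  | .realLe x y => x.eval s ≤ y.eval s

/-- Programs. -/
inductive Cmd where
  | skip
  | setN (a : ℕ) (i j : NExp) (x : NExp)
  | setR (a : ℕ) (i j : NExp) (x : RExp)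
  | seq (p q : Cmd)
  | ite (t : Test) (p q : Cmd)
  | loop (t : Test) (p : Cmd)
  | callCover
  | callCode

/-- The two oracles, for covering problems with `nM` rows and `k` columns and for code problems
with `nM` messages and `nE` edges, and the time that one call takes. -/
structure Oracles (nE nM k : ℕ) where
  cover : CoverInstance nM k → Option (Fin k → ℝ)
  code : (Fin nM → Bool) → (Fin nE → ℝ) → Option (Finset (Fin nE))
  coverTime : ℝ
  codeTime : ℝ

variable {nE nM k : ℕ}

/-- The covering problem that is written in memory: the matrix in the natural array 5, the upper
bounds in row 0 of the natural array 6, the right-hand side and the costs in row 0 of the real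
arrays 2 and 3. -/
def coverQuery (nM k : ℕ) (s : Mem) : CoverInstance nM k where
  A := fun i j => s.nat 5 i j
  b := fun i => s.real 2 0 i
  c := fun j => s.real 3 0 j
  u := fun j => s.nat 6 0 j

/-- The answer of the covering oracle: natural array 7 is 1 (solved) or 0 (infeasible) at (0, 0),
row 0 of the real array 4 is the solution. -/
noncomputable def coverStep (O : Oracles nE nM k) (s : Mem) : Mem :=
  match O.cover (coverQuery nM k s) with
  | none => ⟨put s.nat 7 0 0 0, s.real⟩
  | some x => ⟨put s.nat 7 0 0 1, fun a i j =>
      if h : a = 4 ∧ i = 0 ∧ j < k then x ⟨j, h.2.2⟩ else s.real a i j⟩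

/-- A call of the code oracle: the query has the selected messages in row 0 of the natural array 8
(a nonzero entry selects the message) and the lengths in row 0 of the real array 5. In the answer,
natural array 9 is 1 (solved) or 0 (no solution) at (0, 0), and row 0 of the natural array 10 is
the indicator vector of the edges used. -/
noncomputable def codeStep (O : Oracles nE nM k) (s : Mem) : Mem :=
  match O.code (fun m => decide (s.nat 8 0 m ≠ 0)) (fun e => s.real 5 0 e) with
  | none => ⟨put s.nat 9 0 0 0, s.real⟩
  | some U => ⟨put (fun a i j =>
      if h : a = 10 ∧ i = 0 ∧ j < nE then (if ⟨j, h.2.2⟩ ∈ U then 1 else 0)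
      else s.nat a i j) 9 0 0 1, s.real⟩

/-- `Exec O p s t s'`: the program `p`, started in `s`, halts after time `t` in `s'`. Every
assignment and every test takes unit time (the lengths of the expressions are constants of the
program), and a call of an oracle takes the time of that oracle. -/
inductive Exec (O : Oracles nE nM k) : Cmd → Mem → ℝ → Mem → Prop where
  | skip (s : Mem) : Exec O .skip s 1 s
  | setN (a : ℕ) (i j x : NExp) (s : Mem) : Exec O (.setN a i j x) s 1
      ⟨put s.nat a (i.eval s) (j.eval s) (x.eval s), s.real⟩
  | setR (a : ℕ) (i j : NExp) (x : RExp) (s : Mem) : Exec O (.setR a i j x) s 1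
      ⟨s.nat, put s.real a (i.eval s) (j.eval s) (x.eval s)⟩
  | seq {p q : Cmd} {s₁ s₂ s₃ : Mem} {t₁ t₂ : ℝ} :
      Exec O p s₁ t₁ s₂ → Exec O q s₂ t₂ s₃ → Exec O (.seq p q) s₁ (t₁ + t₂) s₃
  | ite_true {c : Test} {p q : Cmd} {s₁ s₂ : Mem} {t : ℝ} :
      c.holds s₁ → Exec O p s₁ t s₂ → Exec O (.ite c p q) s₁ (1 + t) s₂
  | ite_false {c : Test} {p q : Cmd} {s₁ s₂ : Mem} {t : ℝ} :
      ¬ c.holds s₁ → Exec O q s₁ t s₂ → Exec O (.ite c p q) s₁ (1 + t) s₂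
  | loop_done {c : Test} {p : Cmd} {s : Mem} : ¬ c.holds s → Exec O (.loop c p) s 1 s
  | loop_more {c : Test} {p : Cmd} {s₁ s₂ s₃ : Mem} {t₁ t₂ : ℝ} :
      c.holds s₁ → Exec O p s₁ t₁ s₂ → Exec O (.loop c p) s₂ t₂ s₃ →
      Exec O (.loop c p) s₁ (1 + t₁ + t₂) s₃
  | callCover (s : Mem) : Exec O .callCover s O.coverTime (coverStep O s)
  | callCode (s : Mem) : Exec O .callCode s O.codeTime (codeStep O s)

/-- The entry `i` of the vector `v`, and 0 beyond its end. -/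
def entry {α : Type*} [Zero α] {n : ℕ} (v : Fin n → α) (i : ℕ) : α :=
  if h : i < n then v ⟨i, h⟩ else 0

/-- The initial memory of the ray computation. Natural arrays: in row 0 of array 0 the numbers of
nodes, edges, messages and weight vectors; in rows 0, 1, 2 of array 1 the tails, heads and
capacities of the edges; in arrays 2 and 3 the source and receiver mappings; in array 4 the list of
the weight vectors. Real arrays: in row 0 of array 0 the accuracy `ω` and the guarantee `B` of the
covering oracle; in row 0 of array 1 the direction `q` of the ray. All else is 0. -/
noncomputable def initMem (N : CapNetwork) (W : Fin k → Fin N.numM → Bool) (ω B : ℝ)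
    (q : Fin N.numM → ℝ) : Mem where
  nat := fun a i j => match a with
    | 0 => if i = 0 then entry ![N.numV, N.numE, N.numM, k] j else 0
    | 1 => entry ![entry (fun e => (N.tail e : ℕ)) j, entry (fun e => (N.head e : ℕ)) j,
        entry N.cap j] i
    | 2 => entry (fun x => entry (fun m => if m ∈ N.src x then 1 else 0) j) i
    | 3 => entry (fun x => entry (fun m => if m ∈ N.rcv x then 1 else 0) j) i
    | 4 => entry (fun l => entry (fun m => (W l m).toNat) j) i
    | _ => 0
  real := fun a i j => match a with
    | 0 => if i = 0 then entry ![ω, B] j else 0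
    | 1 => if i = 0 then entry q j else 0
    | _ => 0

/-- The output of the ray computation: row 0 of the real array 6. -/
def output (n : ℕ) (s : Mem) : Fin n → ℝ := fun i => s.real 6 0 i

end OracleRAM

/-! ### Restricting, routing and aggregating partial scalar-linear solutions -/

namespace CapNetwork

variable {N : CapNetwork} {F : Type*} [Field F]

/-! The region is a packing polytope. A column is a nonzero weight vector together with the edge set
of one of its partial solutions. A nonnegative rate vector lies in the region if and only if some
nonnegative combination of columns delivers at least these rates and loads no edge beyond its
capacity (`mem_semiRegion_iff`). One inclusion counts coordinates in an aggregate and uses that the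
polytope is closed. The other rounds the coefficients to integers and lets the edge dimension grow.
Thus the largest multiple of a direction `q` is the value of a packing problem, attained and
positive.

This problem is solved approximately by multiplicative weights. Let `b` be `q` scaled to maximum 1
and `lam` the largest multiple of `b` in the region. Every edge has a weight `y e`, at first 1, and
the length `y e / cap e`. In one round the code oracle finds a shortest edge set for each weight
vector, and the covering oracle combines these cheaply into a cover of `b`. If the cover has the
largest relative edge load `ρ`, then `1 / ρ` copies of it are packed, `f` grows by `1 / ρ`, and `y
e` is multiplied by 1 plus `ε` times the relative load just added.

Three estimates are carried through the rounds (`PackingInvariant.step`). By Bernoulli's inequality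
`y e` dominates `(1 + ε)` to the accumulated relative load, so weights at most `(1 + ε) ^ Q` make `f
/ Q` copies of `b` feasible. By weak duality (`exists_cheap_cover`) some cover costs at most `(∑ y)
/ lam`, and the oracle loses a factor `B`, so `∑ y` grows by a factor of at most `exp (ε * B / (ρ *
lam))`. Once some weight reaches `(1 + ε) ^ (Q - 1)`, this bounds `lam` from above by a multiple of
`f` (`PackingInvariant.final`). Finally, a bottleneck edge receives the full factor `1 + ε`, so the
product of the weights grows by at least this factor and there are at most `Q * numE` rounds
(`PackingInvariant.lt`).

With `ε = 1 / p`, `p = ⌈5 / ω⌉` and `Q = p * p * g`, where `g` is about the binary logarithm of the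
number of edges, the total loss is `(1 + ω) * B`. A time-bounded program logic verifies the program
`rayCmd`; as oracle times dominate the query sizes, one round costs a constant multiple of one
covering call and `k'` code calls. -/

theorem mem_usedEdges {d : Fin N.numM → ℕ} {b : Fin N.numE → ℕ} (P : N.Code F d b)
    (e : Fin N.numE) : e ∈ P.usedEdges ↔ ∃ z, P.edgeFun e z ≠ 0 := by
  classical
  simp [Code.usedEdges]

theorem edgeFun_eq_zero_of_notMem {d : Fin N.numM → ℕ} {b : Fin N.numE → ℕ} {P : N.Code F d b}
    {e : Fin N.numE} (h : e ∉ P.usedEdges) (z) : P.edgeFun e z = 0 := by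
  by_contra hz
  exact h ((mem_usedEdges P e).2 ⟨z, hz⟩)

/-- A partial solution can be restricted to fewer messages. -/
theorem IsPartialSolution.restrict {w w' : Fin N.numM → Bool} {P : N.ScalarCode F w}
    (hP : N.IsPartialSolution F P) (hw : ∀ m, w' m = true → w m = true) :
    ∃ P' : N.ScalarCode F w', N.IsPartialSolution F P' ∧ P'.usedEdges ⊆ P.usedEdges := by
  -- The given code is run with the dropped messages set to zero; this substitution is linear, so
  -- linearity survives.
  let emb : ∀ m, (Fin (w' m).toNat → F) → (Fin (w m).toNat → F) := fun m z _ =>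
    if h : w' m = true then z ⟨0, by simp [h]⟩ else 0
  let embIn : ∀ x, N.NodeInput F (fun m => (w' m).toNat) (fun _ => 1) x →
      N.NodeInput F (fun m => (w m).toNat) (fun _ => 1) x := fun x z =>
    (fun m => emb m (z.1 m), z.2)
  have emb_add : ∀ m y z, emb m (y + z) = emb m y + emb m z := by
    intro m y z
    funext i
    by_cases h : w' m = true <;> simp [emb, h]
  have emb_smul : ∀ m (c : F) z, emb m (c • z) = c • emb m z := by
    intro m y z
    funext i
    by_cases h : w' m = true <;> simp [emb, h]
  have in_add : ∀ x y z, embIn x (y + z) = embIn x y + embIn x z := fun x y z =>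
    Prod.ext (funext fun m => emb_add m _ _) rfl
  have in_smul : ∀ x (c : F) z, embIn x (c • z) = c • embIn x z := fun x y z =>
    Prod.ext (funext fun m => emb_smul m _ _) rfl
  have pos : ∀ {m}, ∀ i : Fin (w' m).toNat, 0 < (w m).toNat := fun {m} i => by
    simp [hw m (eq_true_of_fin_toNat i)]
  refine ⟨⟨fun e z => P.edgeFun e (embIn _ z),
    fun x m z i => P.decFun x m (embIn _ z) ⟨0, pos i⟩⟩, ⟨⟨fun e => ⟨?_, ?_⟩, fun x m => ⟨?_, ?_⟩⟩, ?_⟩,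
    ?_⟩
  · intro y z
    simp only [in_add, (hP.1.1 e).map_add]
  · intro c z
    simp only [in_smul, (hP.1.1 e).map_smul]
  · intro y z
    funext i
    simp only [in_add, (hP.1.2 x m).map_add, Pi.add_apply]
  · intro c z
    funext i
    simp only [in_smul, (hP.1.2 x m).map_smul, Pi.smul_apply]
  · intro a s hs x m
    have h := hP.2 (fun m => emb m (a m)) s hs x m
    funext i
    have hi := eq_true_of_fin_toNat i
    refine (congrFun h ⟨0, pos i⟩).trans ?_
    have h0 : (⟨0, by simp [hi]⟩ : Fin (w' m).toNat) = i := by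
      apply Fin.ext
      have := i.2
      simp only [hi, Bool.toNat_true] at this
      simp only
      omega
    simp only [emb, hi, dite_true]
    rw [← h0]
  · intro e he
    obtain ⟨z, hz⟩ := (mem_usedEdges _ e).1 he
    exact (mem_usedEdges _ e).2 ⟨_, hz⟩

/-- A message that is demanded at a node which does not generate it needs an edge. -/
theorem IsPartialSolution.usedEdges_nonempty {w : Fin N.numM → Bool} {P : N.ScalarCode F w}
    (hP : N.IsPartialSolution F P) (hN : N.Nondegenerate) {m : Fin N.numM} {x : Fin N.numV}
    (hx : m ∈ N.rcv x) (hm : w m = true) : P.usedEdges.Nonempty := by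
  classical
  by_contra hne
  rw [Finset.not_nonempty_iff_eq_empty] at hne
  have hz : ∀ e z, P.edgeFun e z = 0 := fun e z =>
    edgeFun_eq_zero_of_notMem (by simp [hne]) z
  -- The node `x` does not generate `m` and all its in-edges carry 0, so it cannot tell this
  -- assignment from the zero assignment, although they differ in `m`.
  let a : ∀ m', Fin (w m').toNat → F := fun m' _ => if m' = m then 1 else 0
  have h1 := hP.2 a (fun _ => 0) (fun e => (hz e _).symm) x ⟨m, hx⟩
  have h0 := hP.2 (fun _ => 0) (fun _ => 0) (fun e => (hz e _).symm) x ⟨m, hx⟩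
  have hv : N.view a (fun _ : Fin N.numE => (0 : Fin 1 → F)) x =
      N.view (fun m' => (0 : Fin (w m').toNat → F)) (fun _ => 0) x := by
    refine Prod.ext (funext fun m' => ?_) rfl
    have : m'.1 ≠ m := fun h => Finset.disjoint_left.1 (hN.2 x) (h ▸ m'.2) hx
    funext i
    simp [view, a, this]
  rw [hv, h0] at h1
  have := congrFun h1 ⟨0, by simp [hm]⟩
  simp [a] at this

/-- Routing: each single message can be sent to all its receivers. -/
theorem exists_partialSolution_single (N : CapNetwork) (F : Type*) [Field F]
    (hN : N.Nondegenerate) (m₀ : Fin N.numM) :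
    ∃ P : N.ScalarCode F (fun m => decide (m = m₀)), N.IsPartialSolution F P := by
  classical
  let R : Fin N.numV → Prop := fun v => ∃ y, m₀ ∈ N.src y ∧ Relation.ReflTransGen N.Adj y v
  -- A node that does not generate the message copies it from one chosen in-edge whose tail is
  -- reachable from a generator. Acyclicity makes the induction along these edges well-founded.
  let get : ∀ v, N.NodeInput F (fun m => (decide (m = m₀)).toNat) (fun _ => 1) v → F := fun v z =>
    if h : m₀ ∈ N.src v then z.1 ⟨m₀, h⟩ ⟨0, by simp⟩
    else if h : ∃ e, N.head e = v ∧ R (N.tail e) then z.2 ⟨h.choose, h.choose_spec.1⟩ 0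
    else 0
  have get_add : ∀ v y z, get v (y + z) = get v y + get v z := by
    intro v y z
    simp only [get]
    split_ifs <;> simp
  have get_smul : ∀ v (c : F) z, get v (c • z) = c • get v z := by
    intro v y z
    simp only [get]
    split_ifs <;> simp
  refine ⟨⟨fun e z _ => get _ z, fun x m z _ => get x z⟩,
    ⟨fun e => ⟨?_, ?_⟩, fun x m => ⟨?_, ?_⟩⟩, ?_⟩
  · intro y z
    funext i
    exact get_add _ _ _
  · intro c z
    funext i
    exact get_smul _ _ _
  · intro y z
    funext i
    exact get_add _ _ _
  · intro c z
    funext i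
    exact get_smul _ _ _
  intro a s hs x m
  have key : ∀ v, R v → get v (N.view a s v) = a m₀ ⟨0, by simp⟩ := by
    have wf : WellFounded (Relation.TransGen N.Adj) := by
      have : Std.Irrefl (Relation.TransGen N.Adj) := ⟨fun v => N.acyclic v⟩
      exact Finite.wellFounded_of_trans_of_irrefl _
    intro v
    induction v using wf.induction with
    | _ v ih =>
      intro hv
      by_cases h : m₀ ∈ N.src v
      · simp [get, h, view]
      · have h2 : ∃ e, N.head e = v ∧ R (N.tail e) := by
          obtain ⟨y, hy, hyv⟩ := hv
          rcases Relation.ReflTransGen.cases_tail hyv with h' | ⟨u, hu, e, he, he'⟩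
          · exact absurd (h' ▸ hy) h
          · exact ⟨e, he', y, hy, he ▸ hu⟩
        have hg : get v (N.view a s v) = s h2.choose 0 := by
          simp only [get, h, h2, dite_true, dite_false, view]
        rw [hg, hs]
        exact ih _ (.single ⟨_, rfl, h2.choose_spec.1⟩) h2.choose_spec.2
  funext i
  have hm : m.1 = m₀ := by simpa using eq_true_of_fin_toNat i
  have hR : R x := by
    obtain ⟨y, hy, hyx⟩ := hN.1 x _ m.2
    exact ⟨y, hm ▸ hy, hyx⟩
  refine (key x hR).trans ?_
  obtain ⟨m, hm'⟩ := m
  subst hm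
  congr 1
  apply Fin.ext
  have := i.2
  simp at this
  simp [this]

/-- Partial solutions that fit into the edges can be aggregated. -/
theorem mem_simpleRates_of_exact {T : ℕ} {w : Fin T → Fin N.numM → Bool}
    (P : ∀ t, N.ScalarCode F (w t)) (sol : ∀ t, N.IsPartialSolution F (P t)) {n : ℕ} (hn : 0 < n)
    (load : ∀ e, Nat.card {t // e ∈ (P t).usedEdges} ≤ n * N.cap e) {k : Fin N.numM → ℕ}
    (hk : ∀ m, 0 < k m) (card : ∀ m, Nat.card {t // w t m = true} = k m) :
    (fun m => (k m : ℝ) / n) ∈ N.simpleRates F := by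
  classical
  have mslot : ∀ m, {t // w t m = true} ≃ Fin (k m) := fun m => Finite.equivFinOfCardEq (card m)
  have heslot : ∀ e, Nonempty ({t // e ∈ (P t).usedEdges} ↪ Fin (n * N.cap e)) := fun e => by
    apply Function.Embedding.nonempty_of_card_le
    rw [Fintype.card_fin, ← Nat.card_eq_fintype_card]
    exact load e
  have eslot : ∀ e, {t // e ∈ (P t).usedEdges} ↪ Fin (n * N.cap e) := fun e => (heslot e).some
  let part : ∀ t x, N.NodeInput F k (fun e => n * N.cap e) x →
      N.NodeInput F (fun m => (w t m).toNat) (fun _ => 1) x := fun t x z =>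
    (fun m i => z.1 m (mslot m ⟨t, eq_true_of_fin_toNat i⟩),
      fun e _ => if h : e.1 ∈ (P t).usedEdges then z.2 e (eslot e ⟨t, h⟩) else 0)
  have part_add : ∀ t x y z, part t x (y + z) = part t x y + part t x z := by
    intro t x y z
    refine Prod.ext rfl (funext fun e => funext fun i => ?_)
    by_cases h : e.1 ∈ (P t).usedEdges <;> simp [part, h]
  have part_smul : ∀ t x (c : F) z, part t x (c • z) = c • part t x z := by
    intro t x y z
    refine Prod.ext rfl (funext fun e => funext fun i => ?_)
    by_cases h : e.1 ∈ (P t).usedEdges <;> simp [part, h]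
  let dec : ∀ x, ∀ m : {m // m ∈ N.rcv x}, N.NodeInput F k (fun e => n * N.cap e) x →
      ∀ t : {t // w t m = true}, F := fun x m z t =>
    (P t).decFun x m (part t x z) ⟨0, by simp [t.2]⟩
  let C : N.FracCode F k n :=
    { edgeFun := fun e z j => if h : ∃ t, eslot e t = j then
        (P h.choose).edgeFun e (part h.choose (N.tail e) z) 0 else 0
      decFun := fun x m z j => dec x m z ((mslot m).symm j) }
  have edge_eq : ∀ e, ∀ t : {t // e ∈ (P t).usedEdges}, ∀ z,
      C.edgeFun e z (eslot e t) = (P t).edgeFun e (part t (N.tail e) z) 0 := by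
    intro e t z
    have h : ∃ t', eslot e t' = eslot e t := ⟨t, rfl⟩
    have ht : h.choose = t := (eslot e).injective h.choose_spec
    simp only [C, h, dite_true]
    rw [ht]
  have dec_eq : ∀ x, ∀ m : {m // m ∈ N.rcv x}, ∀ t, ∀ i : Fin (w t m).toNat, ∀ z,
      C.decFun x m z (mslot m ⟨t, eq_true_of_fin_toNat i⟩) =
        (P t).decFun x m (part t x z) i := by
    intro x m t i z
    simp only [C, Equiv.symm_apply_apply, dec]
    congr 1
    apply Fin.ext
    have := i.2
    simp [eq_true_of_fin_toNat i] at this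
    simp [this]
  refine ⟨k, n, hk, hn, ⟨C, ⟨fun e => ⟨?_, ?_⟩, fun x m => ⟨?_, ?_⟩⟩, ?_, ⟨?_⟩⟩, rfl⟩
  · intro y z
    funext j
    by_cases h : ∃ t, eslot e t = j
    · simp only [C, h, dite_true, part_add, ((sol _).1.1 e).map_add, Pi.add_apply]
    · simp only [C, h, dite_false, Pi.add_apply, add_zero]
  · intro c z
    funext j
    by_cases h : ∃ t, eslot e t = j
    · simp only [C, h, dite_true, part_smul, ((sol _).1.1 e).map_smul, Pi.smul_apply]
    · simp only [C, h, dite_false, Pi.smul_apply, smul_zero]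
  · intro y z
    funext j
    simp only [C, dec, part_add, ((sol _).1.2 x m).map_add, Pi.add_apply]
  · intro c z
    funext j
    simp only [C, dec, part_smul, ((sol _).1.2 x m).map_smul, Pi.smul_apply]
  · intro a s hs x m
    funext j
    obtain ⟨⟨t, ht⟩, rfl⟩ := (mslot m).surjective j
    let i : Fin (w t m).toNat := ⟨0, by simp [ht]⟩
    refine (dec_eq x m t i _).trans ?_
    -- The coordinates that belong to `t` form by themselves a run of `P t`, so `P t` decodes them.
    have hc : (P t).Carries (fun m i => a m (mslot m ⟨t, eq_true_of_fin_toNat i⟩))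
        (fun e _ => if h : e ∈ (P t).usedEdges then s e (eslot e ⟨t, h⟩) else 0) := by
      intro e
      funext i
      by_cases h : e ∈ (P t).usedEdges
      · simp only [h, dite_true]
        rw [hs e, edge_eq e ⟨t, h⟩]
        rw [Subsingleton.elim i 0]
        rfl
      · simp only [h, dite_false]
        rw [edgeFun_eq_zero_of_notMem h]
        rfl
    exact congrFun ((sol t).2 _ _ hc x m) i
  · exact ⟨T, w, P, sol, mslot, eslot, part, fun _ _ _ _ _ => rfl, fun _ _ _ _ _ => rfl, edge_eq,
      fun e j h z => by
        have h' : ¬ ∃ t, eslot e t = j := fun ⟨t, ht⟩ => h t ht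
        simp only [C, h', dite_false], dec_eq⟩

/-- Partial solutions that fit into the edges can be aggregated, and excess copies of a message can
be dropped. -/
theorem mem_simpleRates {ι : Type*} [Finite ι] {w : ι → Fin N.numM → Bool}
    (P : ∀ t, N.ScalarCode F (w t)) (sol : ∀ t, N.IsPartialSolution F (P t)) {n : ℕ} (hn : 0 < n)
    (load : ∀ e, Nat.card {t // e ∈ (P t).usedEdges} ≤ n * N.cap e) {k : Fin N.numM → ℕ}
    (hk : ∀ m, 0 < k m) (card : ∀ m, k m ≤ Nat.card {t // w t m = true}) :
    (fun m => (k m : ℝ) / n) ∈ N.simpleRates F := by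
  classical
  have := Fintype.ofFinite ι
  have hS : ∀ m, ∃ S : Finset ι, (∀ t ∈ S, w t m = true) ∧ S.card = k m := by
    intro m
    have h := card m
    rw [Nat.card_eq_fintype_card, Fintype.card_subtype] at h
    obtain ⟨S, hS, hc⟩ := Finset.exists_subset_card_eq h
    exact ⟨S, fun t ht => (Finset.mem_filter.1 (hS ht)).2, hc⟩
  choose S hSw hSk using hS
  -- For each message exactly `k m` solutions are kept as its carriers; each solution is restricted
  -- to the messages that selected it, which uses no new edge.
  have hP : ∀ t, ∃ P' : N.ScalarCode F (fun m => decide (t ∈ S m)),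
      N.IsPartialSolution F P' ∧ P'.usedEdges ⊆ (P t).usedEdges := fun t =>
    (sol t).restrict fun m hm => hSw m t (by simpa using hm)
  choose P' sol' sub using hP
  let E := Fintype.equivFin ι
  refine mem_simpleRates_of_exact (fun t => P' (E.symm t)) (fun t => sol' _) hn (fun e => ?_) hk
    fun m => ?_
  · refine le_trans ?_ (load e)
    exact Nat.card_le_card_of_injective
      (fun t : {t // e ∈ (P' (E.symm t)).usedEdges} =>
        (⟨E.symm t, sub _ t.2⟩ : {t // e ∈ (P t).usedEdges}))
      fun t t' h => Subtype.ext (E.symm.injective (congrArg Subtype.val h))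
  · rw [← hSk m, ← Nat.card_eq_finsetCard]
    exact Nat.card_congr (E.symm.subtypeEquiv fun t => by simp)

end CapNetwork

/-! ### The region as a packing polytope -/

open Filter Topology

namespace CapNetwork

/-- A partial solution for the messages `w` that uses the edges `U` exists. -/
def IsSolvable (N : CapNetwork) (F : Type*) [Field F] (w : Fin N.numM → Bool)
    (U : Finset (Fin N.numE)) : Prop :=
  ∃ P : N.ScalarCode F w, N.IsPartialSolution F P ∧ P.usedEdges = U

/-- The pairs of a nonzero weight vector and the edge set of one of its partial solutions. -/
abbrev Column (N : CapNetwork) (F : Type*) [Field F] :=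
  {p : (Fin N.numM → Bool) × Finset (Fin N.numE) // (∃ m, p.1 m = true) ∧ N.IsSolvable F p.1 p.2}

noncomputable instance (N : CapNetwork) (F : Type*) [Field F] : Fintype (N.Column F) :=
  Fintype.ofFinite _

/-- The amount of message `m` that is delivered by a fractional combination of partial solutions. -/
noncomputable def delivered {N : CapNetwork} {F : Type*} [Field F] (z : N.Column F → ℝ)
    (m : Fin N.numM) : ℝ := ∑ p, if p.1.1 m = true then z p else 0

/-- The load that a fractional combination of partial solutions puts on the edge `e`. -/
noncomputable def edgeLoad {N : CapNetwork} {F : Type*} [Field F] (z : N.Column F → ℝ)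
    (e : Fin N.numE) : ℝ := ∑ p, if e ∈ p.1.2 then z p else 0

/-- The demands `v` can be covered by partial solutions with edge loads at most `d`. -/
def Packs (N : CapNetwork) (F : Type*) [Field F] (v : Fin N.numM → ℝ) (d : Fin N.numE → ℝ) :
    Prop :=
  ∃ z : N.Column F → ℝ, (∀ p, 0 ≤ z p) ∧ (∀ m, v m ≤ delivered z m) ∧ ∀ e, edgeLoad z e ≤ d e

variable {N : CapNetwork} {F : Type*} [Field F]

theorem IsSolvable.nonempty {w : Fin N.numM → Bool} {U : Finset (Fin N.numE)}
    (h : N.IsSolvable F w U) (hN : N.Nondegenerate) (hd : ∀ m, ∃ x, m ∈ N.rcv x) {m : Fin N.numM}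
    (hm : w m = true) : U.Nonempty := by
  obtain ⟨P, hP, rfl⟩ := h
  obtain ⟨x, hx⟩ := hd m
  exact hP.usedEdges_nonempty hN hx hm

theorem Column.nonempty (p : N.Column F) (hN : N.Nondegenerate) (hd : ∀ m, ∃ x, m ∈ N.rcv x) :
    p.1.2.Nonempty := by
  obtain ⟨m, hm⟩ := p.2.1
  exact p.2.2.nonempty hN hd hm

theorem Packs.mono {v v' : Fin N.numM → ℝ} {d d' : Fin N.numE → ℝ} (h : N.Packs F v d)
    (hv : ∀ m, v' m ≤ v m) (hd : ∀ e, d e ≤ d' e) : N.Packs F v' d' := by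
  obtain ⟨z, h0, h1, h2⟩ := h
  exact ⟨z, h0, fun m => (hv m).trans (h1 m), fun e => (h2 e).trans (hd e)⟩

theorem Packs.smul {v : Fin N.numM → ℝ} {d : Fin N.numE → ℝ} (h : N.Packs F v d) {c : ℝ}
    (hc : 0 ≤ c) : N.Packs F (fun m => c * v m) (fun e => c * d e) := by
  obtain ⟨z, h0, h1, h2⟩ := h
  refine ⟨fun p => c * z p, fun p => mul_nonneg hc (h0 p), fun m => ?_, fun e => ?_⟩
  · refine (mul_le_mul_of_nonneg_left (h1 m) hc).trans_eq ?_
    simp only [delivered, Finset.mul_sum, mul_ite, mul_zero]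
  · refine Eq.trans_le ?_ (mul_le_mul_of_nonneg_left (h2 e) hc)
    simp only [edgeLoad, Finset.mul_sum, mul_ite, mul_zero]

theorem Packs.add {v v' : Fin N.numM → ℝ} {d d' : Fin N.numE → ℝ} (h : N.Packs F v d)
    (h' : N.Packs F v' d') : N.Packs F (fun m => v m + v' m) (fun e => d e + d' e) := by
  obtain ⟨z, h0, h1, h2⟩ := h
  obtain ⟨z', h0', h1', h2'⟩ := h'
  refine ⟨fun p => z p + z' p, fun p => add_nonneg (h0 p) (h0' p), fun m => ?_, fun e => ?_⟩
  · refine (add_le_add (h1 m) (h1' m)).trans_eq ?_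
    simp only [delivered, ← Finset.sum_add_distrib]
    exact Finset.sum_congr rfl fun p _ => by split_ifs <;> simp
  · refine Eq.trans_le ?_ (add_le_add (h2 e) (h2' e))
    simp only [edgeLoad, ← Finset.sum_add_distrib]
    exact Finset.sum_congr rfl fun p _ => by split_ifs <;> simp

theorem packs_zero : N.Packs F 0 0 :=
  ⟨0, by simp, by simp [delivered], by simp [edgeLoad]⟩

/-- A combination of finitely many partial solutions with weights `c`. -/
theorem packs_sum {ι : Type*} [Fintype ι] {w : ι → Fin N.numM → Bool}
    {U : ι → Finset (Fin N.numE)} (h : ∀ i, N.IsSolvable F (w i) (U i)) {c : ι → ℝ}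
    (hc : ∀ i, 0 ≤ c i) :
    N.Packs F (fun m => ∑ i, if w i m = true then c i else 0)
      (fun e => ∑ i, if e ∈ U i then c i else 0) := by
  classical
  -- Indices with the same pair pool their weights. An index with a zero weight vector belongs to no
  -- column; it delivers nothing, and omitting it only lowers loads.
  refine ⟨fun p => ∑ i, if (w i, U i) = p.1 then c i else 0,
    fun p => Finset.sum_nonneg fun i _ => ite_nonneg (hc i) le_rfl, fun m => ?_, fun e => ?_⟩
  · have : delivered (N := N) (F := F) (fun p => ∑ i, if (w i, U i) = p.1 then c i else 0) m =
        ∑ i, ∑ p : N.Column F, if (w i, U i) = p.1 ∧ w i m = true then c i else 0 := by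
      rw [Finset.sum_comm]
      refine Finset.sum_congr rfl fun p _ => ?_
      by_cases hp : p.1.1 m = true
      · rw [if_pos hp]
        refine Finset.sum_congr rfl fun i _ => if_congr ?_ rfl rfl
        exact ⟨fun h => ⟨h, by rw [← h] at hp; exact hp⟩, fun h => h.1⟩
      · rw [if_neg hp]
        refine (Finset.sum_eq_zero fun i _ => if_neg ?_).symm
        rintro ⟨h1, h2⟩
        rw [← h1] at hp
        exact hp h2
    rw [this]
    refine Finset.sum_le_sum fun i _ => ?_
    by_cases hi : w i m = true
    · rw [if_pos hi]
      refine le_trans (le_of_eq ?_) (Finset.single_le_sum (f := fun p : N.Column F =>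
        if (w i, U i) = p.1 ∧ w i m = true then c i else 0)
        (fun p _ => ite_nonneg (hc i) le_rfl)
        (Finset.mem_univ ⟨(w i, U i), ⟨m, hi⟩, h i⟩))
      simp [hi]
    · rw [if_neg hi]
      exact Finset.sum_nonneg fun p _ => ite_nonneg (hc i) le_rfl
  · have : edgeLoad (N := N) (F := F) (fun p => ∑ i, if (w i, U i) = p.1 then c i else 0) e =
        ∑ i, ∑ p : N.Column F, if (w i, U i) = p.1 ∧ e ∈ U i then c i else 0 := by
      rw [Finset.sum_comm]
      refine Finset.sum_congr rfl fun p _ => ?_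
      by_cases hp : e ∈ p.1.2
      · rw [if_pos hp]
        refine Finset.sum_congr rfl fun i _ => if_congr ?_ rfl rfl
        exact ⟨fun h => ⟨h, by rw [← h] at hp; exact hp⟩, fun h => h.1⟩
      · rw [if_neg hp]
        refine (Finset.sum_eq_zero fun i _ => if_neg ?_).symm
        rintro ⟨h1, h2⟩
        rw [← h1] at hp
        exact hp h2
    rw [this]
    refine Finset.sum_le_sum fun i _ => ?_
    by_cases hi : e ∈ U i
    · simp only [hi, if_true, and_true]
      rw [← Finset.sum_filter]
      refine (Finset.sum_le_card_nsmul _ _ (c i) fun p _ => le_rfl).trans ?_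
      have : (Finset.univ.filter fun p : N.Column F => (w i, U i) = p.1).card ≤ 1 := by
        refine Finset.card_le_one.2 fun a ha b hb => Subtype.ext ?_
        rw [← (Finset.mem_filter.1 ha).2, ← (Finset.mem_filter.1 hb).2]
      rw [nsmul_eq_mul]
      exact mul_le_of_le_one_left (hc i) (by exact_mod_cast this)
    · simp [hi]

/-- A routing of each single message. -/
theorem exists_solvable_single (N : CapNetwork) (F : Type*) [Field F] (hN : N.Nondegenerate)
    (m : Fin N.numM) : ∃ U, N.IsSolvable F (fun m' => decide (m' = m)) U := by
  obtain ⟨P, hP⟩ := exists_partialSolution_single N F hN m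
  exact ⟨_, P, hP, rfl⟩

/-- One routing per message is superposed, so an edge is used at most once for each message. -/
theorem packs_one (N : CapNetwork) (F : Type*) [Field F] (hN : N.Nondegenerate) :
    N.Packs F (fun _ => 1) (fun _ => N.numM) := by
  choose U hU using exists_solvable_single N F hN
  refine (packs_sum (F := F) hU (c := fun _ => 1) fun _ => zero_le_one).mono (fun m => ?_)
    fun e => ?_
  · simp
  · refine (Finset.sum_le_card_nsmul _ _ 1 fun p _ => ?_).trans ?_
    · split_ifs <;> simp
    · simp

theorem le_edgeLoad {z : N.Column F → ℝ} (hz : ∀ p, 0 ≤ z p) {p : N.Column F} {e : Fin N.numE}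
    (he : e ∈ p.1.2) : z p ≤ edgeLoad z e := by
  refine le_trans (le_of_eq ?_) (Finset.single_le_sum (f := fun p : N.Column F =>
        if e ∈ p.1.2 then z p else 0)
        (fun p _ => ite_nonneg (hz p) le_rfl) (Finset.mem_univ p))
  simp [he]

/-- Every column uses an edge, so the load bounds confine each coefficient to a bounded interval.
The coefficients therefore range over a compact set, and projecting along a compact factor preserves
closedness. -/
theorem isClosed_packs (hN : N.Nondegenerate) (hd : ∀ m, ∃ x, m ∈ N.rcv x) (d : Fin N.numE → ℝ) :
    IsClosed {v | N.Packs F v d} := by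
  let Z : Set (N.Column F → ℝ) := {z | (∀ p, 0 ≤ z p) ∧ ∀ e, edgeLoad z e ≤ d e}
  have hcl : ∀ e, Continuous fun z : N.Column F → ℝ => edgeLoad z e := fun e =>
    continuous_finsetSum _ fun p _ => by split_ifs <;> fun_prop
  have hcd : ∀ m, Continuous fun z : N.Column F → ℝ => delivered z m := fun e =>
    continuous_finsetSum _ fun p _ => by split_ifs <;> fun_prop
  have hZc : IsClosed Z := by
    have : Z = (⋂ p, {z | 0 ≤ z p}) ∩ ⋂ e, {z | edgeLoad z e ≤ d e} := by
      ext
      simp [Z]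
    rw [this]
    exact (isClosed_iInter fun p => isClosed_le continuous_const (continuous_apply p)).inter
      (isClosed_iInter fun e => isClosed_le (hcl e) continuous_const)
  have hZ : IsCompact Z := by
    have hp : ∀ p : N.Column F, ∃ e, e ∈ p.1.2 := fun p => p.nonempty hN hd
    choose f hf using hp
    refine IsCompact.of_isClosed_subset (isCompact_Icc (a := 0) (b := fun p => d (f p))) hZc ?_
    intro z hz
    exact ⟨fun p => hz.1 p, fun p => (le_edgeLoad hz.1 (hf p)).trans (hz.2 _)⟩
  have := isCompact_iff_compactSpace.1 hZ
  have hC : IsClosed {x : (Fin N.numM → ℝ) × Z | ∀ m, x.1 m ≤ delivered x.2.1 m} := by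
    simp only [Set.ofPred_forall]
    refine isClosed_iInter fun m => isClosed_le (by fun_prop) ?_
    exact (hcd m).comp (continuous_subtype_val.comp continuous_snd)
  convert isClosedMap_fst_of_compactSpace _ hC using 1
  ext v
  constructor
  · rintro ⟨z, h0, h1, h2⟩
    exact ⟨(v, ⟨z, h0, h2⟩), h1, rfl⟩
  · rintro ⟨⟨_, z, h0, h2⟩, h1, rfl⟩
    exact ⟨z, h0, h1, h2⟩

/-- Each member of the aggregate gets weight `1 / n`: the slots count the members that carry a
message, and bound the number that use an edge. -/
theorem packs_of_mem_simpleRates {r : Fin N.numM → ℝ} (hr : r ∈ N.simpleRates F) :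
    (∀ m, 0 ≤ r m) ∧ N.Packs F r (fun e => N.cap e) := by
  classical
  obtain ⟨k, n, hk, hn, ⟨C, hC, hS, ⟨A⟩⟩, rfl⟩ := hr
  refine ⟨fun m => by positivity, ?_⟩
  have hn' : (0 : ℝ) < n := by exact_mod_cast hn
  refine (packs_sum (F := F) (w := A.w) (U := fun t => (A.P t).usedEdges)
    (fun t => ⟨A.P t, A.sol t, rfl⟩) (c := fun _ => (n : ℝ)⁻¹) fun _ => by positivity).mono
    (fun m => ?_) fun e => ?_
  · rw [← Finset.sum_filter, Finset.sum_const, ← Fintype.card_subtype,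
      Fintype.card_congr (A.mslot m), Fintype.card_fin, nsmul_eq_mul, div_eq_mul_inv]
  · rw [← Finset.sum_filter, Finset.sum_const, ← Fintype.card_subtype, nsmul_eq_mul]
    have := Fintype.card_le_of_embedding (A.eslot e)
    rw [Fintype.card_fin] at this
    rw [← div_eq_mul_inv, div_le_iff₀ hn', mul_comm]
    exact_mod_cast this

theorem card_sum_sigma_subtype {α β : Type*} [Fintype α] [Fintype β] (M : α → ℕ)
    (φ : α → Prop) [DecidablePred φ] (ψ : β → Prop) [DecidablePred ψ] :
    Nat.card {t : (Σ a, Fin (M a)) ⊕ β // Sum.elim (fun s => φ s.1) ψ t} =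
      (∑ a, if φ a then M a else 0) + ∑ b, if ψ b then 1 else 0 := by
  classical
  rw [Nat.card_eq_fintype_card, Fintype.card_subtype, Finset.card_filter, Fintype.sum_sum_type,
    Fintype.sum_sigma]
  refine congrArg₂ _ (Finset.sum_congr rfl fun a _ => ?_) (Finset.sum_congr rfl fun b _ => ?_)
  · by_cases h : φ a <;> simp [h]
  · by_cases h : ψ b <;> simp [h]

/-- Each column is used `⌊z p * n⌋` times. A simple solution needs every source dimension positive,
so one routing of each message is added; the edge dimension `n + numM` pays for this, and the extra
terms vanish as `n` grows. -/
theorem mem_semiRegion_of_packs (hN : N.Nondegenerate) {r : Fin N.numM → ℝ} (h0 : ∀ m, 0 ≤ r m)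
    (h : N.Packs F r (fun e => N.cap e)) : r ∈ N.semiRegion F := by
  classical
  obtain ⟨z, hz, hv, hl⟩ := h
  choose U hU using exists_solvable_single N F hN
  let M : ℕ → N.Column F → ℕ := fun n p => ⌊z p * n⌋₊
  let cnt : ℕ → Fin N.numM → ℕ := fun n m => ∑ p : N.Column F, if p.1.1 m = true then M n p else 0
  -- The minimum discards whatever is delivered beyond `r m`, and the 1 is the additional routing.
  let k : ℕ → Fin N.numM → ℕ := fun n m => min ⌊r m * n⌋₊ (cnt n m) + 1
  have hMz : ∀ n p, (M n p : ℝ) ≤ z p * n := fun n p =>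
    Nat.floor_le (mul_nonneg (hz p) (Nat.cast_nonneg n))
  have hmem : ∀ n, 0 < n → (fun m => (k n m : ℝ) / (n + N.numM : ℕ)) ∈ N.simpleRates F := by
    intro n hn
    let w : (Σ p : N.Column F, Fin (M n p)) ⊕ Fin N.numM → Fin N.numM → Bool :=
      Sum.elim (fun s => s.1.1.1) fun m m' => decide (m' = m)
    let V : (Σ p : N.Column F, Fin (M n p)) ⊕ Fin N.numM → Finset (Fin N.numE) :=
      Sum.elim (fun s => s.1.1.2) U
    have hs : ∀ t, N.IsSolvable F (w t) (V t) := by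
      rintro (s | m)
      · exact s.1.2.2
      · exact hU m
    choose P hP hPV using hs
    refine mem_simpleRates P hP (by omega) (fun e => ?_) (fun m => by simp [k]) fun m => ?_
    · simp only [hPV]
      have hc : Nat.card {t // e ∈ V t} = _ :=
        (Nat.card_congr (Equiv.subtypeEquivRight (by rintro (s | m) <;> simp [V]))).trans
        (card_sum_sigma_subtype (M n) (fun p => e ∈ p.1.2) fun m => e ∈ U m)
      rw [hc, add_mul]
      refine add_le_add ?_ ?_
      · have h1 : ((∑ p : N.Column F, if e ∈ p.1.2 then M n p else 0 : ℕ) : ℝ) ≤ n * N.cap e := by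
          refine le_trans ?_ (mul_le_mul_of_nonneg_left (hl e) (Nat.cast_nonneg n))
          push_cast
          rw [edgeLoad, Finset.mul_sum]
          refine Finset.sum_le_sum fun p _ => ?_
          split_ifs
          · rw [mul_comm]
            exact hMz n p
          · simp
        exact_mod_cast h1
      · refine (Finset.sum_le_card_nsmul _ _ 1 fun m _ => ?_).trans ?_
        · split_ifs <;> simp
        · simp only [Finset.card_univ, Fintype.card_fin, smul_eq_mul, mul_one]
          exact Nat.le_mul_of_pos_right _ (N.cap_pos e)
    · have hc : Nat.card {t // w t m = true} = _ :=
        (Nat.card_congr (Equiv.subtypeEquivRight (by rintro (s | m) <;> simp [w]))).trans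
        (card_sum_sigma_subtype (M n) (fun p => p.1.1 m = true) fun m' => m = m')
      rw [hc]
      refine add_le_add (min_le_right _ _) (by simp)
  refine mem_closure_of_tendsto (f := fun (n : ℕ) m => (k n m : ℝ) / (n + N.numM : ℕ))
    (b := atTop) ?_ ((eventually_gt_atTop 0).mono hmem)
  rw [tendsto_pi_nhds]
  intro m
  have hfl : ∀ a : ℝ, 0 ≤ a → Tendsto (fun n : ℕ => (⌊a * n⌋₊ : ℝ) / n) atTop (𝓝 a) :=
    fun a ha => (tendsto_nat_floor_mul_div_atTop ha).comp tendsto_natCast_atTop_atTop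
  have h1 : Tendsto (fun n : ℕ => (cnt n m : ℝ) / n) atTop (𝓝 (delivered z m)) := by
    have : (fun n : ℕ => (cnt n m : ℝ) / n) =
        fun n : ℕ => ∑ p : N.Column F, if p.1.1 m = true then (⌊z p * n⌋₊ : ℝ) / n else 0 := by
      funext n
      simp only [cnt, M]
      push_cast
      rw [Finset.sum_div]
      exact Finset.sum_congr rfl fun p _ => by split_ifs <;> simp
    rw [this]
    refine tendsto_finsetSum _ fun p _ => ?_
    split_ifs
    · exact hfl _ (hz p)
    · exact tendsto_const_nhds
  have h2 := ((hfl _ (h0 m)).min h1).add tendsto_one_div_atTop_nhds_zero_nat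
  have h3 := h2.mul (tendsto_natCast_div_add_atTop (𝕜 := ℝ) (N.numM : ℝ))
  rw [min_eq_left (hv m), add_zero, mul_one] at h3
  refine h3.congr' ((eventually_gt_atTop 0).mono fun n hn => ?_)
  have hn' : (0 : ℝ) < n := by exact_mod_cast hn
  simp only [k]
  rw [min_div_div_right hn'.le]
  push_cast
  field_simp

theorem mem_semiRegion_iff (hN : N.Nondegenerate) (hd : ∀ m, ∃ x, m ∈ N.rcv x)
    {r : Fin N.numM → ℝ} :
    r ∈ N.semiRegion F ↔ (∀ m, 0 ≤ r m) ∧ N.Packs F r (fun e => N.cap e) := by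
  refine ⟨fun h => ?_, fun h => mem_semiRegion_of_packs hN h.1 h.2⟩
  have hc : IsClosed {r : Fin N.numM → ℝ | (∀ m, 0 ≤ r m) ∧ N.Packs F r (fun e => N.cap e)} := by
    refine IsClosed.inter ?_ (isClosed_packs hN hd _)
    exact isClosed_Ici (a := (0 : Fin N.numM → ℝ))
  exact closure_minimal (fun r hr => packs_of_mem_simpleRates hr) hc h

/-- Each column that delivers the message is charged to at least one edge. This makes the ray leave
the region. -/
theorem delivered_le_sum (hN : N.Nondegenerate) (hd : ∀ m, ∃ x, m ∈ N.rcv x) {z : N.Column F → ℝ}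
    (hz : ∀ p, 0 ≤ z p) (m : Fin N.numM) : delivered z m ≤ ∑ e, edgeLoad z e := by
  simp only [edgeLoad]
  rw [Finset.sum_comm]
  refine Finset.sum_le_sum fun p _ => ?_
  obtain ⟨e, he⟩ := p.nonempty hN hd
  refine le_trans (b := z p) (by split_ifs <;> simp [hz p]) ?_
  refine le_trans (le_of_eq ?_) (Finset.single_le_sum (f := fun e =>
        if e ∈ p.1.2 then z p else 0)
        (fun e _ => ite_nonneg (hz p) le_rfl) (Finset.mem_univ e))
  simp [he]

/-- The ray in a nonzero direction leaves the region at a positive point. -/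
theorem exists_isGreatest_ray (hN : N.Nondegenerate) (hd : ∀ m, ∃ x, m ∈ N.rcv x)
    {q : Fin N.numM → ℝ} (hq : ∀ m, 0 ≤ q m) (hq0 : q ≠ 0) :
    ∃ lam : ℝ, 0 < lam ∧ IsGreatest {x : ℝ | x • q ∈ N.semiRegion F} lam := by
  obtain ⟨m, hm⟩ := Function.ne_iff.1 hq0
  have hm : 0 < q m := lt_of_le_of_ne (hq m) (Ne.symm hm)
  let S := {x : ℝ | x • q ∈ N.semiRegion F}
  have hS : IsClosed S := isClosed_closure.preimage (by fun_prop : Continuous fun x : ℝ => x • q)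
  have hb : BddAbove S := by
    refine ⟨(∑ e, (N.cap e : ℝ)) / q m, fun x hx => ?_⟩
    obtain ⟨-, z, hz, h1, h2⟩ := (mem_semiRegion_iff hN hd).1 hx
    rw [le_div_iff₀ hm]
    exact ((h1 m).trans (delivered_le_sum hN hd hz m)).trans
      (Finset.sum_le_sum fun e _ => h2 e)
  have hpos : ∃ x, 0 < x ∧ x ∈ S := by
    have hM : (0 : ℝ) < N.numM := by exact_mod_cast m.pos
    have hs : 0 < ∑ m, q m := Finset.sum_pos' (fun m _ => hq m) ⟨m, Finset.mem_univ _, hm⟩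
    -- This multiple of `q` has entries at most `1 / numM`; superposed routings at that rate load
    -- each edge by at most 1, and capacities are at least 1.
    refine ⟨((N.numM : ℝ) * ∑ m, q m)⁻¹, by positivity, ?_⟩
    refine (mem_semiRegion_iff hN hd).2 ⟨fun m => mul_nonneg (by positivity) (hq m), ?_⟩
    refine ((packs_one N F hN).smul (c := (N.numM : ℝ)⁻¹) (by positivity)).mono (fun m' => ?_)
      fun e => ?_
    · simp only [Pi.smul_apply, smul_eq_mul, mul_inv, mul_assoc]
      refine mul_le_mul_of_nonneg_left ?_ (by positivity)
      rw [inv_mul_le_iff₀ hs, mul_one]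
      exact Finset.single_le_sum (fun m _ => hq m) (Finset.mem_univ m')
    · rw [inv_mul_cancel₀ hM.ne']
      exact_mod_cast N.cap_pos e
  obtain ⟨x, hx, hxS⟩ := hpos
  refine ⟨sSup S, hx.trans_le (le_csSup hb hxS), hS.csSup_mem ⟨x, hxS⟩ hb, fun y hy => le_csSup hb hy⟩

end CapNetwork

/-! ### Multiplicative weights: duality, invariant and final guarantee -/

open Filter Topology

namespace CapNetwork

variable {N : CapNetwork} {F : Type*} [Field F]

/-- Double counting: weighting edge loads by lengths is the same as pricing each edge set by its
length. -/
theorem sum_length_eq {l : Fin N.numE → ℝ} {k : ℕ} (U : Fin k → Finset (Fin N.numE))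
    (x : Fin k → ℝ) :
    ∑ e, l e * (∑ j, if e ∈ U j then x j else 0) = ∑ j, (∑ e ∈ U j, l e) * x j := by
  classical
  simp only [Finset.mul_sum, Finset.sum_mul]
  rw [Finset.sum_comm]
  refine Finset.sum_congr rfl fun j _ => ?_
  rw [← Finset.sum_filter_add_sum_filter_not Finset.univ (fun e => e ∈ U j)]
  rw [Finset.filter_mem_eq_inter, Finset.univ_inter]
  rw [Finset.sum_eq_zero (s := Finset.univ.filter fun e => ¬ e ∈ U j), add_zero]
  · exact Finset.sum_congr rfl fun e he => by rw [if_pos he]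
  · intro e he
    rw [if_neg (Finset.mem_filter.1 he).2, mul_zero]

/-- Weak duality: for positive lengths some cover of `b` costs at most `∑ l c / lam`. -/
theorem exists_cheap_cover (hN : N.Nondegenerate) (hd : ∀ m, ∃ x, m ∈ N.rcv x) {k : ℕ}
    {W : Fin k → Fin N.numM → Bool} (hinj : Function.Injective W)
    (hsurj : ∀ w, N.IsWeightVector F w → ∃ j, W j = w)
    {b : Fin N.numM → ℝ} (hb1 : ∀ m, b m ≤ 1) {lam : ℝ} (hlam : 0 < lam)
    (hp : N.Packs F (fun m => lam * b m) (fun e => N.cap e))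
    {l : Fin N.numE → ℝ} (hl : ∀ e, 0 < l e) {U : Fin k → Finset (Fin N.numE)}
    (hU : ∀ j, N.IsSolvable F (W j) (U j))
    (hmin : ∀ j V, N.IsSolvable F (W j) V → ∑ e ∈ U j, l e ≤ ∑ e ∈ V, l e)
    {cost : Fin k → ℝ} (hcost : ∀ j, cost j = if ∑ e ∈ U j, l e ≤ 0 then 1 else ∑ e ∈ U j, l e) :
    ∃ x : Fin k → ℝ, (∀ j, 0 ≤ x j ∧ x j ≤ 1) ∧
      (∀ m, b m ≤ ∑ j, if W j m = true then x j else 0) ∧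
      ∑ j, cost j * x j ≤ (∑ e, l e * N.cap e) / lam := by
  classical
  obtain ⟨z, hz, hv, hd'⟩ := hp
  -- The optimal packing, divided by `lam` to cover `b` once, with the columns of one weight vector
  -- merged.
  let S : Fin k → ℝ := fun j => lam⁻¹ * ∑ p : N.Column F, if p.1.1 = W j then z p else 0
  have hS : ∀ j, 0 ≤ S j := fun j =>
    mul_nonneg (by positivity) (Finset.sum_nonneg fun p _ => ite_nonneg (hz p) le_rfl)
  have hidx : ∀ p : N.Column F, ∃ j, W j = p.1.1 := fun p => by
    obtain ⟨P, hP, -⟩ := p.2.2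
    exact hsurj _ ⟨P, hP⟩
  choose J hJ using hidx
  have hiff : ∀ (p : N.Column F) j, p.1.1 = W j ↔ J p = j := fun p j => by
    rw [← hJ p]
    exact hinj.eq_iff
  have hcpos : ∀ j, 0 < cost j := fun j => by
    rw [hcost]
    split_ifs with h
    · exact one_pos
    · exact not_le.1 h
  have hswap : ∀ g : Fin k → ℝ, ∑ j, g j * S j = lam⁻¹ * ∑ p : N.Column F, g (J p) * z p := by
    intro g
    simp only [S, Finset.mul_sum]
    rw [Finset.sum_comm]
    refine Finset.sum_congr rfl fun p _ => ?_
    rw [Finset.sum_eq_single (J p)]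
    · rw [if_pos ((hiff p _).2 rfl)]
      ring
    · intro j _ hj
      rw [if_neg fun h => hj ((hiff p j).1 h).symm]
      simp
    · simp
  refine ⟨fun j => min 1 (S j), fun j => ⟨le_min zero_le_one (hS j), min_le_left _ _⟩,
    fun m => ?_, ?_⟩
  -- Truncation at 1 is harmless: a truncated weight vector containing `m` covers `b m ≤ 1` alone,
  -- and otherwise no relevant term was changed.
  · by_cases h : ∃ j, W j m = true ∧ 1 ≤ S j
    · obtain ⟨j, hj, h1⟩ := h
      refine (hb1 m).trans (le_trans (le_of_eq ?_) (Finset.single_le_sum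
        (f := fun j => if W j m = true then min 1 (S j) else 0)
        (fun i _ => ite_nonneg (le_min zero_le_one (hS i)) le_rfl) (Finset.mem_univ j)))
      simp [hj, h1]
    · push Not at h
      have h1 : (∑ j, if W j m = true then min 1 (S j) else 0) =
          ∑ j, (if W j m = true then 1 else 0) * S j := by
        refine Finset.sum_congr rfl fun j _ => ?_
        split_ifs with hj
        · rw [min_eq_right (h j hj).le, one_mul]
        · rw [zero_mul]
      rw [h1, hswap, le_inv_mul_iff₀ hlam]
      refine (hv m).trans_eq (Finset.sum_congr rfl fun p _ => ?_)
      rw [hJ]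
      split_ifs <;> simp
  · calc ∑ j, cost j * min 1 (S j) ≤ ∑ j, cost j * S j :=
          Finset.sum_le_sum fun j _ => mul_le_mul_of_nonneg_left (min_le_right _ _) (hcpos j).le
      _ = lam⁻¹ * ∑ p : N.Column F, cost (J p) * z p := hswap _
      _ ≤ lam⁻¹ * ∑ p : N.Column F, (∑ e ∈ p.1.2, l e) * z p := by
          refine mul_le_mul_of_nonneg_left (Finset.sum_le_sum fun p _ =>
            mul_le_mul_of_nonneg_right ?_ (hz p)) (by positivity)
          obtain ⟨m, hm⟩ := p.2.1
          -- The substitute cost 1 is only for empty edge sets, which nonzero weight vectors never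
          -- have.
          have hne : (U (J p)).Nonempty := (hU _).nonempty hN hd (m := m) (by rw [hJ]; exact hm)
          rw [hcost, if_neg (not_le.2 (Finset.sum_pos (fun e _ => hl e) hne))]
          exact hmin _ _ (by rw [hJ]; exact p.2.2)
      _ = lam⁻¹ * ∑ e, l e * edgeLoad z e := by
          congr 1
          let E := Fintype.equivFin (N.Column F)
          have := sum_length_eq (l := l) (fun j => (E.symm j).1.2) (fun j => z (E.symm j))
          rw [← Equiv.sum_comp E.symm, ← this]
          refine Finset.sum_congr rfl fun e _ => ?_
          rw [edgeLoad, ← Equiv.sum_comp E.symm]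
      _ ≤ lam⁻¹ * ∑ e, l e * N.cap e :=
          mul_le_mul_of_nonneg_left (Finset.sum_le_sum fun e _ =>
            mul_le_mul_of_nonneg_left (hd' e) (hl e).le) (by positivity)
      _ = (∑ e, l e * N.cap e) / lam := by rw [div_eq_inv_mul]

/-- The invariant of the multiplicative weights iteration: after `t` rounds, the amount `f` of the
demand `b` has been packed and the edges have the weights `y`. -/
structure PackingInvariant (N : CapNetwork) (F : Type*) [Field F] (b : Fin N.numM → ℝ)
    (ε B lam : ℝ) (t : ℕ) (f : ℝ) (y : Fin N.numE → ℝ) : Prop where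
  nonneg : 0 ≤ f
  one_le : ∀ e, 1 ≤ y e
  packs : ∃ d, N.Packs F (fun m => f * b m) d ∧ ∀ e, (1 + ε) ^ (d e / N.cap e) ≤ y e
  sum_le : ∑ e, y e ≤ N.numE * Real.exp (ε * B * f / lam)
  le_prod : (1 + ε) ^ t ≤ ∏ e, y e

theorem PackingInvariant.zero {b : Fin N.numM → ℝ} {ε B lam : ℝ} :
    N.PackingInvariant F b ε B lam 0 0 (fun _ => 1) where
  nonneg := le_rfl
  one_le := fun _ => le_rfl
  packs := ⟨0, packs_zero.mono (by simp) (by simp), by simp⟩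
  sum_le := by simp
  le_prod := by simp

/-- After division by the bottleneck `ρ` every relative load lies in `[0, 1]` and some edge attains
1. The first fact gives the bound on packed loads by Bernoulli's inequality, the second the growth
of the product. The sum of the weights is controlled by comparing the oracle's cover with the cheap
cover of weak duality. -/
theorem PackingInvariant.step (hN : N.Nondegenerate) (hd : ∀ m, ∃ x, m ∈ N.rcv x) {k : ℕ}
    {W : Fin k → Fin N.numM → Bool} (hinj : Function.Injective W)
    (hsurj : ∀ w, N.IsWeightVector F w → ∃ j, W j = w)
    {b : Fin N.numM → ℝ} (hb1 : ∀ m, b m ≤ 1) (hb : ∃ m, 0 < b m)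
    {ε B lam : ℝ} (hε : 0 < ε) (hB : 0 ≤ B) (hlam : 0 < lam)
    (hp : N.Packs F (fun m => lam * b m) (fun e => N.cap e))
    {t : ℕ} {f : ℝ} {y : Fin N.numE → ℝ} (h : N.PackingInvariant F b ε B lam t f y)
    {l : Fin N.numE → ℝ} (hl : ∀ e, l e = y e / N.cap e) {U : Fin k → Finset (Fin N.numE)}
    (hU : ∀ j, N.IsSolvable F (W j) (U j))
    (hmin : ∀ j V, N.IsSolvable F (W j) V → ∑ e ∈ U j, l e ≤ ∑ e ∈ V, l e)
    {cost : Fin k → ℝ} (hcost : ∀ j, cost j = if ∑ e ∈ U j, l e ≤ 0 then 1 else ∑ e ∈ U j, l e)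
    {x : Fin k → ℝ} (hx : ∀ j, 0 ≤ x j) (hxb : ∀ m, b m ≤ ∑ j, if W j m = true then x j else 0)
    (hopt : ∀ x' : Fin k → ℝ, (∀ j, 0 ≤ x' j ∧ x' j ≤ 1) →
      (∀ m, b m ≤ ∑ j, if W j m = true then x' j else 0) →
      ∑ j, cost j * x j ≤ B * ∑ j, cost j * x' j)
    {a : Fin N.numE → ℝ} (ha : ∀ e, a e = ∑ j, if e ∈ U j then x j else 0)
    {ρ : ℝ} (hρ : ∀ e, a e / N.cap e ≤ ρ) (hρ' : ρ = 0 ∨ ∃ e, a e / N.cap e = ρ) :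
    N.PackingInvariant F b ε B lam (t + 1) (f + 1 / ρ)
      (fun e => y e * (1 + ε * (a e / N.cap e / ρ))) ∧
      ∀ e, y e * (1 + ε * (a e / N.cap e / ρ)) ≤ y e * (1 + ε) := by
  classical
  have hc : ∀ e, (0 : ℝ) < N.cap e := fun e => by exact_mod_cast N.cap_pos e
  have hy : ∀ e, 0 < y e := fun e => one_pos.trans_le (h.one_le e)
  have hl0 : ∀ e, 0 < l e := fun e => by rw [hl]; exact div_pos (hy e) (hc e)
  have ha0 : ∀ e, 0 ≤ a e := fun e => by
    rw [ha]
    exact Finset.sum_nonneg fun j _ => ite_nonneg (hx j) le_rfl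
  -- A positive demand forces a weight vector with positive coefficient, and its edge set is
  -- nonempty.
  have hρ0 : 0 < ρ := by
    obtain ⟨m, hm⟩ := hb
    obtain ⟨j, -, hj⟩ := Finset.exists_lt_of_sum_lt (s := Finset.univ)
      (f := fun _ : Fin k => (0 : ℝ)) (by simpa using hm.trans_le (hxb m))
    have hW : W j m = true := by
      by_contra h'
      simp [h'] at hj
    simp only [hW, if_true] at hj
    obtain ⟨e, he⟩ := (hU j).nonempty hN hd hW
    refine lt_of_lt_of_le (div_pos (hj.trans_le ?_) (hc e)) (hρ e)
    rw [ha]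
    refine le_trans (le_of_eq ?_) (Finset.single_le_sum (f := fun j => if e ∈ U j then x j else 0)
      (fun i _ => ite_nonneg (hx i) le_rfl) (Finset.mem_univ j))
    simp [he]
  have hfrac : ∀ e, 0 ≤ a e / N.cap e / ρ := fun e => by have := ha0 e; have := hc e; positivity
  have hfrac1 : ∀ e, a e / N.cap e / ρ ≤ 1 := fun e => (div_le_one hρ0).2 (hρ e)
  have hfac : ∀ e, 1 ≤ 1 + ε * (a e / N.cap e / ρ) := fun e => by
    have := mul_nonneg hε.le (hfrac e)
    linarith
  have hle : ∀ e, y e * (1 + ε * (a e / N.cap e / ρ)) ≤ y e * (1 + ε) := fun e =>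
    mul_le_mul_of_nonneg_left (by nlinarith [hfrac1 e]) (hy e).le
  refine ⟨⟨?_, fun e => ?_, ?_, ?_, ?_⟩, hle⟩
  · have := h.nonneg
    positivity
  · exact one_le_mul_of_one_le_of_one_le (h.one_le e) (hfac e)
  · obtain ⟨d, hd1, hd2⟩ := h.packs
    have hnew := ((packs_sum (F := F) hU hx).mono hxb fun e => (ha e).ge).smul
      (c := 1 / ρ) (by positivity)
    refine ⟨_, (hd1.add hnew).mono (fun m => by rw [add_mul]) fun e => le_rfl, fun e => ?_⟩
    rw [add_div, Real.rpow_add (by positivity)]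
    refine mul_le_mul (hd2 e) ?_ (by positivity) (hy e).le
    have h1 : 1 / ρ * a e / N.cap e = a e / N.cap e / ρ := by
      have := hc e
      field_simp
    rw [h1, mul_comm ε]
    -- Bernoulli's inequality for exponents in `[0, 1]`; the division by `ρ` puts them there.
    exact rpow_one_add_le_one_add_mul_self (by linarith) (hfrac e) (hfrac1 e)
  · obtain ⟨x', hx', hx'b, hx'c⟩ := exists_cheap_cover hN hd hinj hsurj hb1 hlam hp hl0 hU hmin
      hcost
    have hlen : ∑ e, l e * a e ≤ B * ((∑ e, y e) / lam) := by
      simp only [ha]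
      rw [sum_length_eq]
      refine le_trans (Finset.sum_le_sum fun j _ => mul_le_mul_of_nonneg_right ?_ (hx j))
        ((hopt x' hx' hx'b).trans (mul_le_mul_of_nonneg_left (hx'c.trans_eq ?_) hB))
      · rw [hcost]
        split_ifs with h'
        · exact h'.trans zero_le_one
        · exact le_rfl
      · congr 1
        refine Finset.sum_congr rfl fun e _ => ?_
        rw [hl, div_mul_cancel₀ _ (hc e).ne']
    have hY : 0 ≤ ∑ e, y e := Finset.sum_nonneg fun e _ => (hy e).le
    calc ∑ e, y e * (1 + ε * (a e / N.cap e / ρ))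
        = ∑ e, y e + ε / ρ * ∑ e, l e * a e := by
          rw [Finset.mul_sum, ← Finset.sum_add_distrib]
          refine Finset.sum_congr rfl fun e _ => ?_
          rw [hl]
          ring
      _ ≤ ∑ e, y e + ε / ρ * (B * ((∑ e, y e) / lam)) := by gcongr
      _ = (∑ e, y e) * (ε * B * (1 / ρ) / lam + 1) := by ring
      _ ≤ (∑ e, y e) * Real.exp (ε * B * (1 / ρ) / lam) :=
          mul_le_mul_of_nonneg_left (Real.add_one_le_exp _) hY
      _ ≤ N.numE * Real.exp (ε * B * f / lam) * Real.exp (ε * B * (1 / ρ) / lam) :=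
          mul_le_mul_of_nonneg_right h.sum_le (Real.exp_pos _).le
      _ = N.numE * Real.exp (ε * B * (f + 1 / ρ) / lam) := by
          rw [mul_assoc, ← Real.exp_add]
          congr 2
          ring
  · rcases hρ' with h' | ⟨e₀, he₀⟩
    · exact absurd h' hρ0.ne'
    rw [Finset.prod_mul_distrib, pow_succ]
    refine mul_le_mul h.le_prod ?_ (by positivity) (Finset.prod_nonneg fun e _ => (hy e).le)
    -- The bottleneck edge alone contributes `1 + ε`, and all other factors are at least 1.
    rw [← Finset.mul_prod_erase _ _ (Finset.mem_univ e₀), he₀, div_self hρ0.ne', mul_one]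
    exact le_mul_of_one_le_right (by linarith) (Finset.one_le_prod fun e _ => hfac e)

/-- While all weights are small, only few rounds have passed. -/
theorem PackingInvariant.lt {b : Fin N.numM → ℝ} {ε B lam : ℝ} (hε : 0 < ε) {t : ℕ} {f : ℝ}
    {y : Fin N.numE → ℝ} (h : N.PackingInvariant F b ε B lam t f y) {R : ℕ}
    (hy : ∀ e, y e < (1 + ε) ^ R) : t ≤ R * N.numE := by
  have h1 : (1 + ε) ^ t ≤ (1 + ε) ^ (R * N.numE) := by
    refine h.le_prod.trans ((Finset.prod_le_prod
      (fun e _ => zero_le_one.trans (h.one_le e)) fun e _ => (hy e).le).trans_eq ?_)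
    rw [Finset.prod_const, Finset.card_univ, Fintype.card_fin, pow_mul]
  exact (pow_le_pow_iff_right₀ (by linarith)).1 h1

/-- The bound `2 * ε / (ε + 2) ≤ log (1 + ε)` in a form with an explicit quadratic loss. -/
theorem log_one_add_ge {ε : ℝ} (hε : 0 ≤ ε) : ε * (1 - ε / 2) ≤ Real.log (1 + ε) := by
  refine le_trans ?_ (Real.le_log_one_add_of_nonneg hε)
  rw [le_div_iff₀ (by positivity)]
  nlinarith [pow_nonneg hε 3]

/-- The guarantee at the end of the iteration. -/
theorem PackingInvariant.final (hN : N.Nondegenerate) {b : Fin N.numM → ℝ} (hb0 : ∀ m, 0 ≤ b m)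
    {p g : ℕ} {B lam ω : ℝ} (hω : 0 < ω) (hω1 : ω ≤ 1) (hp : 5 ≤ p * ω) (hg : 1 ≤ g)
    (hgE : N.numE ≤ 2 ^ g) (hlam : 0 < lam)
    (hgreat : ∀ x, x • b ∈ N.semiRegion F → x ≤ lam) {t : ℕ} {f : ℝ}
    {y : Fin N.numE → ℝ} (h : N.PackingInvariant F b (1 / p) B lam t f y)
    (hy : ∀ e, y e ≤ (1 + 1 / (p : ℝ)) ^ (p * p * g))
    (hy' : ∃ e, (1 + 1 / (p : ℝ)) ^ (p * p * g - 1) ≤ y e) :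
    f / (p * p * g) ≤ lam ∧ lam ≤ (1 + ω) * B * (f / (p * p * g)) := by
  have hpω : 5 ≤ (p : ℝ) := hp.trans (mul_le_of_le_one_right (Nat.cast_nonneg p) hω1)
  have hp0 : (0 : ℝ) < p := by linarith
  have hg' : (1 : ℝ) ≤ g := by exact_mod_cast hg
  set ε : ℝ := 1 / p with hεdef
  have hε : 0 < ε := by positivity
  have hεω : 5 * ε ≤ ω := by
    rw [hεdef, mul_one_div, div_le_iff₀ hp0]
    linarith
  set Q : ℕ := p * p * g with hQ
  have hp1 : 1 ≤ p := by
    have : (0 : ℝ) < p := hp0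
    exact_mod_cast this
  have hQ1 : 1 ≤ Q := Nat.mul_pos (Nat.mul_pos hp1 hp1) hg
  have hQr : (Q : ℝ) = p * p * g := by simp [hQ]
  have hQ0 : (0 : ℝ) < Q := by exact_mod_cast hQ1
  rw [← hQr]
  have hcap : ∀ e, (0 : ℝ) < N.cap e := fun e => by exact_mod_cast N.cap_pos e
  constructor
  · apply hgreat
    obtain ⟨d, hd1, hd2⟩ := h.packs
    refine mem_semiRegion_of_packs hN
      (fun m => mul_nonneg (div_nonneg h.nonneg hQ0.le) (hb0 m)) ?_
    refine (hd1.smul (c := 1 / (Q : ℝ)) (by positivity)).mono (fun m => ?_) fun e => ?_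
    · simp only [Pi.smul_apply, smul_eq_mul]
      apply le_of_eq
      ring
    -- Comparing exponents of `1 + ε` shows that the accumulated load of `e` is at most `Q` times
    -- its capacity.
    · have h1 : (1 + ε) ^ (d e / N.cap e) ≤ (1 + ε) ^ (Q : ℝ) := by
        rw [Real.rpow_natCast]
        exact (hd2 e).trans (hy e)
      have h2 := (Real.rpow_le_rpow_left_iff (by linarith)).1 h1
      rw [div_le_iff₀ (hcap e)] at h2
      rw [one_div, inv_mul_le_iff₀ hQ0]
      exact h2
  · obtain ⟨e₀, he₀⟩ := hy'
    have hm : (0 : ℝ) < N.numE := by exact_mod_cast e₀.pos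
    have hsum : (1 + ε) ^ (Q - 1) ≤ N.numE * Real.exp (ε * B * f / lam) :=
      he₀.trans ((Finset.single_le_sum (f := y) (fun e _ => zero_le_one.trans (h.one_le e))
        (Finset.mem_univ e₀)).trans h.sum_le)
    have hlog := Real.log_le_log (by positivity) hsum
    rw [Real.log_pow, Real.log_mul hm.ne' (Real.exp_pos _).ne', Real.log_exp,
      Nat.cast_sub hQ1, Nat.cast_one] at hlog
    have hlm : Real.log N.numE ≤ g := by
      have : Real.log N.numE ≤ Real.log ((2 : ℝ) ^ g) :=
        Real.log_le_log hm (by exact_mod_cast hgE)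
      rw [Real.log_pow] at this
      have h2 := Real.log_two_lt_d9
      nlinarith
    have hQg : (g : ℝ) = Q * ε * ε := by
      rw [hQr, hεdef]
      field_simp
    have hQε : 1 ≤ Q * ε := by
      have : Q * ε = p * g := by
        rw [hQr, hεdef]
        field_simp
      rw [this]
      nlinarith
    have hl1 := log_one_add_ge hε.le
    have hQ1' : (0 : ℝ) ≤ Q - 1 := by
      have : (1 : ℝ) ≤ Q := by exact_mod_cast hQ1
      linarith
    -- The logarithm of `hsum` loses `Q * ε ^ 2 / 2` in `log (1 + ε)`, at most `ε` from the exponent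
    -- `Q - 1`, and at most `g = Q * ε ^ 2` from `log numE`. As `ε ≤ Q * ε ^ 2`, the sum is at most
    -- `5 / 2 * Q * ε ^ 2`.
    have hmain : Q * ε * (1 - 5 / 2 * ε) ≤ ε * B * f / lam := by
      have h1 := mul_le_mul_of_nonneg_left hl1 hQ1'
      have hε1 : ε ≤ 1 / 5 := by linarith
      have h3 : ε ≤ Q * ε * ε := by nlinarith
      nlinarith [mul_pos hε hε]
    have h4 : Q * (1 - 5 / 2 * ε) * lam ≤ B * f := by
      rw [le_div_iff₀ hlam] at hmain
      have : ε * (Q * (1 - 5 / 2 * ε) * lam) ≤ ε * (B * f) := by linarith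
      exact le_of_mul_le_mul_left this hε
    have h5 : Q * lam ≤ (1 + ω) * (Q * (1 - 5 / 2 * ε) * lam) := by
      -- Since `5 * ε ≤ ω`, the second factor is at least `1 - ω / 2`, and `ω ≤ 1`.
      have h6 : 1 ≤ (1 + ω) * (1 - 5 / 2 * ε) := by nlinarith
      have := mul_le_mul_of_nonneg_left h6 (mul_pos hQ0 hlam).le
      linarith
    rw [← mul_div_assoc, le_div_iff₀ hQ0]
    nlinarith [mul_le_mul_of_nonneg_left h4 (by linarith : (0 : ℝ) ≤ 1 + ω)]

end CapNetwork

/-! ### A program logic with time bounds -/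

namespace OracleRAM

variable {nE nM k : ℕ} {O : Oracles nE nM k}

/-- Started in `s`, the program halts within time `t` in a state that satisfies `Q`. -/
def Runs (O : Oracles nE nM k) (p : Cmd) (s : Mem) (t : ℝ) (Q : Mem → Prop) : Prop :=
  ∃ t' s', Exec O p s t' s' ∧ t' ≤ t ∧ Q s'

theorem Runs.mono {p : Cmd} {s : Mem} {t t' : ℝ} {Q Q' : Mem → Prop} (h : Runs O p s t Q)
    (ht : t ≤ t') (hQ : ∀ s', Q s' → Q' s') : Runs O p s t' Q' := by
  obtain ⟨u, s', h1, h2, h3⟩ := h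
  exact ⟨u, s', h1, h2.trans ht, hQ _ h3⟩

theorem Runs.seq {p q : Cmd} {s : Mem} {t₁ t₂ : ℝ} {R Q : Mem → Prop} (hp : Runs O p s t₁ R)
    (hq : ∀ s', R s' → Runs O q s' t₂ Q) : Runs O (.seq p q) s (t₁ + t₂) Q := by
  obtain ⟨u, s', h1, h2, h3⟩ := hp
  obtain ⟨u', s'', h1', h2', h3'⟩ := hq s' h3
  exact ⟨_, s'', .seq h1 h1', add_le_add h2 h2', h3'⟩

theorem Runs.skip {s : Mem} {Q : Mem → Prop} (h : Q s) : Runs O .skip s 1 Q :=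
  ⟨1, s, .skip s, le_rfl, h⟩

theorem Runs.setN {a : ℕ} {i j x : NExp} {s : Mem} {Q : Mem → Prop}
    (h : Q ⟨put s.nat a (i.eval s) (j.eval s) (x.eval s), s.real⟩) :
    Runs O (.setN a i j x) s 1 Q := ⟨1, _, .setN a i j x s, le_rfl, h⟩

theorem Runs.setR {a : ℕ} {i j : NExp} {x : RExp} {s : Mem} {Q : Mem → Prop}
    (h : Q ⟨s.nat, put s.real a (i.eval s) (j.eval s) (x.eval s)⟩) :
    Runs O (.setR a i j x) s 1 Q := ⟨1, _, .setR a i j x s, le_rfl, h⟩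

theorem Runs.ite {c : Test} {p q : Cmd} {s : Mem} {t : ℝ} {Q : Mem → Prop}
    (hp : c.holds s → Runs O p s t Q) (hq : ¬ c.holds s → Runs O q s t Q) :
    Runs O (.ite c p q) s (t + 1) Q := by
  by_cases h : c.holds s
  · obtain ⟨u, s', h1, h2, h3⟩ := hp h
    exact ⟨_, s', .ite_true h h1, by linarith, h3⟩
  · obtain ⟨u, s', h1, h2, h3⟩ := hq h
    exact ⟨_, s', .ite_false h h1, by linarith, h3⟩

theorem Runs.callCover {s : Mem} {Q : Mem → Prop} (h : Q (coverStep O s)) :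
    Runs O .callCover s O.coverTime Q := ⟨_, _, .callCover s, le_rfl, h⟩

theorem Runs.callCode {s : Mem} {Q : Mem → Prop} (h : Q (codeStep O s)) :
    Runs O .callCode s O.codeTime Q := ⟨_, _, .callCode s, le_rfl, h⟩

/-- A loop with the invariant `I`, indexed by the number of rounds, that admits at most `n`
rounds. -/
theorem Runs.loop {c : Test} {p : Cmd} {t : ℝ} (I : ℕ → Mem → Prop) (n : ℕ) (ht : 0 ≤ t)
    (hstep : ∀ i s, I i s → c.holds s → i < n ∧ Runs O p s t (I (i + 1))) {s : Mem} (h0 : I 0 s) :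
    Runs O (.loop c p) s (n * (t + 1) + 1) fun s' => (∃ i ≤ n, I i s') ∧ ¬ c.holds s' := by
  have key : ∀ m i s, i + m = n → I i s →
      Runs O (.loop c p) s (m * (t + 1) + 1) fun s' => (∃ i ≤ n, I i s') ∧ ¬ c.holds s' := by
    intro m
    induction m with
    | zero =>
      intro i s hi hI
      have hc : ¬ c.holds s := fun hc => by
        have := (hstep i s hI hc).1
        omega
      exact ⟨1, s, .loop_done hc, by simp, ⟨i, by omega, hI⟩, hc⟩
    | succ m ih =>
      intro i s hi hI
      by_cases hc : c.holds s
      · obtain ⟨u, s', h1, h2, h3⟩ := (hstep i s hI hc).2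
        obtain ⟨u', s'', h1', h2', h3'⟩ := ih (i + 1) s' (by omega) h3
        refine ⟨_, s'', .loop_more hc h1 h1', ?_, h3'⟩
        push_cast
        linarith
      · refine ⟨1, s, .loop_done hc, ?_, ⟨i, by omega, hI⟩, hc⟩
        have : 0 ≤ ((m + 1 : ℕ) : ℝ) * (t + 1) := by positivity
        linarith
  exact key n 0 s (by omega) h0

/-- The scalar that is stored at the start of the `a`-th natural array. -/
abbrev NExp.var (a : ℕ) : NExp := .cell a (.lit 0) (.lit 0)

/-- The scalar that is stored at the start of the `a`-th real array. -/
abbrev RExp.var (a : ℕ) : RExp := .cell a (.lit 0) (.lit 0)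

/-- `for c < b do p`. -/
def forLoop (c : ℕ) (b : NExp) (p : Cmd) : Cmd :=
  .seq (.setN c (.lit 0) (.lit 0) (.lit 0))
    (.loop (.natLt (.var c) b) (.seq p (.setN c (.lit 0) (.lit 0) (.add (.var c) (.lit 1)))))

/-- Outside the natural arrays `A` and the real arrays `R` the two memories agree. -/
structure Frame (A R : List ℕ) (s s' : Mem) : Prop where
  nat : ∀ a, a ∉ A → s'.nat a = s.nat a
  real : ∀ a, a ∉ R → s'.real a = s.real a

theorem Frame.refl (A R : List ℕ) (s : Mem) : Frame A R s s := ⟨fun _ _ => rfl, fun _ _ => rfl⟩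

/-- For concrete array numbers the four inclusions are decided automatically, so frames of
consecutive commands can be chained without bookkeeping. -/
theorem Frame.trans {A R A' R' A'' R'' : List ℕ} {s s' s'' : Mem} (h : Frame A R s s')
    (h' : Frame A' R' s' s'') (hA : A ⊆ A'' := by decide) (hR : R ⊆ R'' := by decide)
    (hA' : A' ⊆ A'' := by decide) (hR' : R' ⊆ R'' := by decide) : Frame A'' R'' s s'' :=
  ⟨fun a ha => (h'.nat a fun x => ha (hA' x)).trans (h.nat a fun x => ha (hA x)),
    fun a ha => (h'.real a fun x => ha (hR' x)).trans (h.real a fun x => ha (hR x))⟩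

theorem put_same {α : Type*} (f : ℕ → ℕ → ℕ → α) (a i j : ℕ) (v : α) :
    put f a i j v a i j = v := by simp [put]

theorem put_of_ne {α : Type*} (f : ℕ → ℕ → ℕ → α) {a a' : ℕ} (i j : ℕ) (v : α) (h : a' ≠ a) :
    put f a i j v a' = f a' := by
  funext i' j'
  simp [put, h]

theorem put_of_col_ne {α : Type*} (f : ℕ → ℕ → ℕ → α) (a i j a' i' : ℕ) {j' : ℕ} (v : α)
    (h : j' ≠ j) : put f a i j v a' i' j' = f a' i' j' := by
  simp [put, h]

theorem put_of_row_ne {α : Type*} (f : ℕ → ℕ → ℕ → α) (a i j a' j' : ℕ) {i' : ℕ} (v : α)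
    (h : i' ≠ i) : put f a i j v a' i' j' = f a' i' j' := by
  simp [put, h]

theorem frame_put_nat (s : Mem) (a i j v : ℕ) : Frame [a] [] s ⟨put s.nat a i j v, s.real⟩ :=
  ⟨fun a' h => put_of_ne _ _ _ _ (by simpa using h), fun _ _ => rfl⟩

theorem frame_put_real (s : Mem) (a i j : ℕ) (v : ℝ) :
    Frame [] [a] s ⟨s.nat, put s.real a i j v⟩ :=
  ⟨fun _ _ => rfl, fun a' h => put_of_ne _ _ _ _ (by simpa using h)⟩

/-- Each round adds a test and an increment to the body; the final 2 are the initialization and the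
failing test. The bound is evaluated anew in each round, so the invariant must determine its value.
-/
theorem Runs.forLoop {c : ℕ} {b : NExp} {p : Cmd} {t : ℝ} {s : Mem} (I : ℕ → Mem → Prop) (n : ℕ)
    (ht : 0 ≤ t) (h0 : I 0 ⟨put s.nat c 0 0 0, s.real⟩) (hb : ∀ i s', I i s' → b.eval s' = n)
    (hstep : ∀ i < n, ∀ s', I i s' → s'.nat c 0 0 = i →
      Runs O p s' t fun s'' => s''.nat c 0 0 = i ∧ I (i + 1) ⟨put s''.nat c 0 0 (i + 1), s''.real⟩) :
    Runs O (forLoop c b p) s (n * (t + 2) + 2) (I n) := by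
  have h := Runs.loop (O := O) (c := .natLt (.var c) b)
    (p := .seq p (.setN c (.lit 0) (.lit 0) (.add (.var c) (.lit 1)))) (t := t + 1)
    (fun i s' => i ≤ n ∧ I i s' ∧ s'.nat c 0 0 = i) n (by linarith) ?_
    (s := ⟨put s.nat c 0 0 0, s.real⟩) ⟨n.zero_le, h0, put_same _ _ _ _ _⟩
  · refine (Runs.seq (Runs.setN rfl) (R := fun s' => s' = ⟨put s.nat c 0 0 0, s.real⟩)
      fun s' hs' => hs' ▸ h).mono (by ring_nf; rfl) ?_
    rintro s' ⟨⟨i, -, hi, hI, hc⟩, hn⟩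
    have hlt : ¬ i < n := by
      intro hlt
      apply hn
      change s'.nat c 0 0 < b.eval s'
      rw [hb i s' hI, hc]
      exact hlt
    obtain rfl : i = n := by omega
    exact hI
  · rintro i s' ⟨hi, hI, hc⟩ hlt
    change s'.nat c 0 0 < b.eval s' at hlt
    rw [hb i s' hI, hc] at hlt
    refine ⟨hlt, Runs.seq (hstep i hlt s' hI hc) fun s'' ⟨h1, h2⟩ => Runs.setN ?_⟩
    have : (NExp.add (.var c) (.lit 1)).eval s'' = i + 1 := by simp [NExp.eval, h1]
    rw [this]
    exact ⟨hlt, h2, put_same _ _ _ _ _⟩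

/-- Fill row 0 of a real array. -/
def fillR (c a : ℕ) (b : NExp) (x : RExp) : Cmd :=
  forLoop c b (.setR a (.lit 0) (.var c) x)

/-- The expression may read the entry about to be overwritten, because entries not yet reached keep
their old value. The weights are updated in place this way. -/
theorem Runs.fillR {c a : ℕ} {b : NExp} {x : RExp} {s : Mem} (n : ℕ) (v : ℕ → ℝ)
    (hb : ∀ s', Frame [c] [a] s s' → b.eval s' = n)
    (hx : ∀ i < n, ∀ s', Frame [c] [a] s s' → s'.nat c 0 0 = i → s'.real a 0 i = s.real a 0 i →
      x.eval s' = v i) :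
    Runs O (fillR c a b x) s (n * 3 + 2) fun s' =>
      Frame [c] [a] s s' ∧ ∀ i < n, s'.real a 0 i = v i := by
  refine (Runs.forLoop (t := 1) (fun i s' => Frame [c] [a] s s' ∧ (∀ j < i, s'.real a 0 j = v j) ∧
    ∀ j, i ≤ j → s'.real a 0 j = s.real a 0 j) n zero_le_one ?_ ?_ ?_).mono
    (by norm_num) fun s' h => ⟨h.1, h.2.1⟩
  · exact ⟨(frame_put_nat s c 0 0 0).trans (Frame.refl [] [] _) (by simp) (by simp) (by simp)
      (by simp), by simp, fun _ _ => rfl⟩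
  · exact fun i s' h => hb s' h.1
  · rintro i hi s' ⟨h1, h2, h3⟩ hc
    refine Runs.setR ?_
    have hcol : (NExp.var c).eval s' = i := hc
    rw [hx i hi s' h1 hc (h3 i le_rfl), hcol]
    refine ⟨hc, ?_, fun j hj => ?_, fun j hj => ?_⟩
    · exact (h1.trans (frame_put_real s' a 0 i (v i)) (A'' := [c]) (R'' := [a]) (by simp) (by simp)
        (by simp) (by simp)).trans (frame_put_nat _ c 0 0 (i + 1)) (by simp) (by simp) (by simp)
        (by simp)
    · rcases Nat.lt_succ_iff_lt_or_eq.1 hj with hj | rfl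
      · exact (put_of_col_ne _ _ _ _ _ _ _ (by omega)).trans (h2 j hj)
      · exact put_same _ _ _ _ _
    · exact (put_of_col_ne _ _ _ _ _ _ _ (by omega)).trans (h3 j (by omega))

/-- Fill the row `r` of a natural array. -/
def fillN (c a : ℕ) (r b x : NExp) : Cmd :=
  forLoop c b (.setN a r (.var c) x)

theorem Runs.fillN {c a : ℕ} {r b x : NExp} {s : Mem} (hca : c ≠ a) (n r₀ : ℕ) (v : ℕ → ℕ)
    (hb : ∀ s', Frame [c, a] [] s s' → b.eval s' = n)
    (hr : ∀ s', Frame [c, a] [] s s' → r.eval s' = r₀)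
    (hx : ∀ i < n, ∀ s', Frame [c, a] [] s s' → s'.nat c 0 0 = i → x.eval s' = v i) :
    Runs O (fillN c a r b x) s (n * 3 + 2) fun s' =>
      Frame [c, a] [] s s' ∧ (∀ i < n, s'.nat a r₀ i = v i) ∧
        ∀ i j, i ≠ r₀ → s'.nat a i j = s.nat a i j := by
  refine (Runs.forLoop (t := 1) (fun i s' => Frame [c, a] [] s s' ∧ (∀ j < i, s'.nat a r₀ j = v j) ∧
    ∀ i j, i ≠ r₀ → s'.nat a i j = s.nat a i j) n zero_le_one ?_ ?_ ?_).mono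
    (by norm_num) fun s' h => h
  · refine ⟨(frame_put_nat s c 0 0 0).trans (Frame.refl [] [] _) (by simp) (by simp) (by simp)
      (by simp), by simp, fun i j _ => ?_⟩
    exact congrFun (congrFun (put_of_ne _ _ _ _ hca.symm) _) _
  · exact fun i s' h => hb s' h.1
  · rintro i hi s' ⟨h1, h2, h3⟩ hc
    refine Runs.setN ?_
    have hcol : (NExp.var c).eval s' = i := hc
    rw [hx i hi s' h1 hc, hcol, hr s' h1]
    refine ⟨?_, ?_, fun j hj => ?_, fun i' j hj => ?_⟩
    · exact (congrFun (congrFun (put_of_ne _ _ _ _ hca) _) _).trans hc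
    · exact (h1.trans (frame_put_nat s' a r₀ i (v i)) (A'' := [c, a]) (R'' := []) (by simp) (by simp)
        (by simp) (by simp)).trans (frame_put_nat _ c 0 0 (i + 1)) (by simp) (by simp) (by simp)
        (by simp)
    · refine (congrFun (congrFun (put_of_ne _ _ _ _ hca.symm) _) _).trans ?_
      rcases Nat.lt_succ_iff_lt_or_eq.1 hj with hj | rfl
      · exact (put_of_col_ne _ _ _ _ _ _ _ (by omega)).trans (h2 j hj)
      · exact put_same _ _ _ _ _
    · refine (congrFun (congrFun (put_of_ne _ _ _ _ hca.symm) _) _).trans ?_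
      exact (put_of_row_ne _ _ _ _ _ _ _ hj).trans (h3 i' j hj)

/-- Set the entry `j` of row 0 of a real array to a sum. -/
def sumR (c a : ℕ) (j b : NExp) (x : RExp) : Cmd :=
  .seq (.setR a (.lit 0) j (.ofNat (.lit 0)))
    (forLoop c b (.setR a (.lit 0) j (.add (.cell a (.lit 0) j) x)))

theorem Runs.sumR {c a : ℕ} {j b : NExp} {x : RExp} {s : Mem} (n j₀ : ℕ) (v : ℕ → ℝ)
    (hb : ∀ s', Frame [c] [a] s s' → b.eval s' = n)
    (hj : ∀ s', Frame [c] [a] s s' → j.eval s' = j₀)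
    (hx : ∀ i < n, ∀ s', Frame [c] [a] s s' → s'.nat c 0 0 = i → x.eval s' = v i) :
    Runs O (sumR c a j b x) s (n * 3 + 3) fun s' =>
      Frame [c] [a] s s' ∧ s'.real a 0 j₀ = ∑ i ∈ Finset.range n, v i ∧
        ∀ j, j ≠ j₀ → s'.real a 0 j = s.real a 0 j := by
  have hj0 := hj s (Frame.refl _ _ _)
  refine (Runs.seq (Runs.setR rfl) fun s₀ hs₀ => (Runs.forLoop (t := 1) (fun i s' =>
    Frame [c] [a] s s' ∧ s'.real a 0 j₀ = ∑ i ∈ Finset.range i, v i ∧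
    ∀ j, j ≠ j₀ → s'.real a 0 j = s.real a 0 j) n zero_le_one ?_ ?_ ?_)).mono
    (by linarith) fun s' h => h
  · subst hs₀
    refine ⟨(frame_put_real s a _ _ _).trans (frame_put_nat _ c _ _ _)
      (by simp) (by simp) (by simp) (by simp), ?_, fun i hi => ?_⟩
    · simp only [hj0, Finset.range_zero, Finset.sum_empty]
      exact (put_same _ _ _ _ _).trans (by simp [RExp.eval, NExp.eval])
    · exact put_of_col_ne _ _ _ _ _ _ _ (by omega)
  · exact fun i s' h => hb s' h.1
  · rintro i hi s' ⟨h1, h2, h3⟩ hc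
    refine Runs.setR ?_
    have hcol := hj s' h1
    have hval : (RExp.add (.cell a (.lit 0) j) x).eval s' = ∑ i ∈ Finset.range (i + 1), v i := by
      rw [Finset.sum_range_succ, ← hx i hi s' h1 hc, ← h2]
      simp only [RExp.eval, NExp.eval, hcol]
    rw [hval, hcol]
    refine ⟨hc, ?_, put_same _ _ _ _ _, fun j hj => ?_⟩
    · exact (h1.trans (frame_put_real s' a 0 _ _) (A'' := [c]) (R'' := [a]) (by simp) (by simp)
        (by simp) (by simp)).trans (frame_put_nat _ c 0 0 (i + 1)) (by simp) (by simp) (by simp)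
        (by simp)
    · exact (put_of_col_ne _ _ _ _ _ _ _ (by omega)).trans (h3 j hj)

/-- Set a real scalar to a maximum with 0. -/
def maxR (c a : ℕ) (b : NExp) (x : RExp) : Cmd :=
  .seq (.setR a (.lit 0) (.lit 0) (.ofNat (.lit 0)))
    (forLoop c b (.ite (.realLt (.var a) x) (.setR a (.lit 0) (.lit 0) x) .skip))

/-- The search starts from 0, hence the alternative that nothing exceeds it. For the bottleneck and
for the largest weight positivity excludes it later. -/
theorem Runs.maxR {c a : ℕ} {b : NExp} {x : RExp} {s : Mem} (n : ℕ) (v : ℕ → ℝ)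
    (hb : ∀ s', Frame [c] [a] s s' → b.eval s' = n)
    (hx : ∀ i < n, ∀ s', Frame [c] [a] s s' → s'.nat c 0 0 = i → x.eval s' = v i) :
    Runs O (maxR c a b x) s (n * 4 + 3) fun s' =>
      Frame [c] [a] s s' ∧ (∀ i < n, v i ≤ s'.real a 0 0) ∧
        (s'.real a 0 0 = 0 ∨ ∃ i < n, v i = s'.real a 0 0) := by
  refine (Runs.seq (Runs.setR rfl) fun s₀ hs₀ => (Runs.forLoop (t := 2) (fun i s' =>
    Frame [c] [a] s s' ∧ (∀ j < i, v j ≤ s'.real a 0 0) ∧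
        (s'.real a 0 0 = 0 ∨ ∃ j < i, v j = s'.real a 0 0)) n zero_le_two ?_ ?_ ?_)).mono
    (by linarith) fun s' h => h
  · subst hs₀
    refine ⟨(frame_put_real s a _ _ _).trans (frame_put_nat _ c _ _ _)
      (by simp) (by simp) (by simp) (by simp), by simp, Or.inl ?_⟩
    exact (put_same _ _ _ _ _).trans (by simp [RExp.eval, NExp.eval])
  · exact fun i s' h => hb s' h.1
  · rintro i hi s' ⟨h1, h2, h3⟩ hc
    have hv := hx i hi s' h1 hc
    have htest : (Test.realLt (.var a) x).holds s' ↔ s'.real a 0 0 < v i := by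
      simp only [Test.holds, hv, RExp.eval, NExp.eval]
    refine (Runs.ite (t := 1) (fun ht => ?_) fun ht => ?_).mono (by norm_num) fun _ h => h
    · rw [htest] at ht
      refine Runs.setR ?_
      rw [hv]
      refine ⟨hc, ?_, fun j hj => ?_, Or.inr ⟨i, by omega, (put_same _ _ _ _ _).symm⟩⟩
      · exact (h1.trans (frame_put_real s' a 0 _ _) (A'' := [c]) (R'' := [a]) (by simp) (by simp)
          (by simp) (by simp)).trans (frame_put_nat _ c 0 0 (i + 1)) (by simp) (by simp) (by simp)
          (by simp)
      · refine le_of_le_of_eq ?_ (put_same _ _ _ _ _).symm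
        rcases Nat.lt_succ_iff_lt_or_eq.1 hj with hj | rfl
        · exact (h2 j hj).trans ht.le
        · exact le_rfl
    · rw [htest, not_lt] at ht
      refine Runs.skip ⟨hc, ?_, fun j hj => ?_, ?_⟩
      · exact h1.trans (frame_put_nat _ c 0 0 (i + 1)) (by simp) (by simp) (by simp) (by simp)
      · rcases Nat.lt_succ_iff_lt_or_eq.1 hj with hj | rfl
        · exact h2 j hj
        · exact ht
      · exact h3.imp id fun ⟨j, hj, h⟩ => ⟨j, by omega, h⟩

end OracleRAM

/-! ### The commands of one round -/

namespace OracleRAM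

variable {k : ℕ} {N : CapNetwork}

theorem entry_of_lt {α : Type*} [Zero α] {n : ℕ} (v : Fin n → α) {i : ℕ} (h : i < n) :
    entry v i = v ⟨i, h⟩ := dif_pos h

theorem entry_fin {α : Type*} [Zero α] {n : ℕ} (v : Fin n → α) (i : Fin n) : entry v i = v i :=
  entry_of_lt v i.2

theorem sum_range_entry {n : ℕ} (v : Fin n → ℝ) : ∑ i ∈ Finset.range n, entry v i = ∑ i, v i := by
  rw [Finset.sum_range]
  simp only [entry_fin]

/-- The number of edges, of messages, and of weight vectors. -/
abbrev edgeCount : NExp := .cell 0 (.lit 0) (.lit 1)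
abbrev msgCount : NExp := .cell 0 (.lit 0) (.lit 2)
abbrev weightCount : NExp := .cell 0 (.lit 0) (.lit 3)

/-- The constants of the iteration are in memory: the network, the covering problem with the right
hand side `b`, the precision `p`, the threshold `R` and the denominator `Q`. -/
structure Ready (N : CapNetwork) (W : Fin k → Fin N.numM → Bool) (b : Fin N.numM → ℝ) (p R Q : ℝ)
    (s : Mem) : Prop where
  numE : s.nat 0 0 1 = N.numE
  numM : s.nat 0 0 2 = N.numM
  numW : s.nat 0 0 3 = k
  cap : ∀ e : Fin N.numE, s.nat 1 2 e = N.cap e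
  weight : ∀ (j : Fin k) (m : Fin N.numM), s.nat 4 j m = (W j m).toNat
  matrix : ∀ (m : Fin N.numM) (j : Fin k), s.nat 5 m j = (W j m).toNat
  bound : ∀ j : Fin k, s.nat 6 0 j = 1
  demand : ∀ m : Fin N.numM, s.real 2 0 m = b m
  prec : s.real 11 0 0 = p
  thr : s.real 12 0 0 = R
  den : s.real 16 0 0 = Q

/-- The two lists hold the arrays that a round or the final output may write; the constants of the
iteration are stored elsewhere. -/
theorem Ready.frame {W : Fin k → Fin N.numM → Bool} {b : Fin N.numM → ℝ} {p R Q : ℝ} {s s' : Mem}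
    (h : Ready N W b p R Q s) {A' R' : List ℕ} (hF : Frame A' R' s s')
    (hA : A' ⊆ [7, 8, 9, 10, 12, 20, 21] := by decide)
    (hR : R' ⊆ [3, 4, 5, 6, 7, 8, 9, 13, 14] := by decide) : Ready N W b p R Q s' := by
  have hn : ∀ a, a ∉ [7, 8, 9, 10, 12, 20, 21] → s'.nat a = s.nat a := fun a ha =>
    hF.nat a fun h' => ha (hA h')
  have hr : ∀ a, a ∉ [3, 4, 5, 6, 7, 8, 9, 13, 14] → s'.real a = s.real a := fun a ha =>
    hF.real a fun h' => ha (hR h')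
  obtain ⟨h1, h2, h3, h4, h5, h6, h7, h8, h9, h10, h11⟩ := h
  constructor
  · rw [hn 0 (by decide), h1]
  · rw [hn 0 (by decide), h2]
  · rw [hn 0 (by decide), h3]
  · rwa [hn 1 (by decide)]
  · rwa [hn 4 (by decide)]
  · rwa [hn 5 (by decide)]
  · rwa [hn 6 (by decide)]
  · rwa [hr 2 (by decide)]
  · rw [hr 11 (by decide), h9]
  · rw [hr 12 (by decide), h10]
  · rw [hr 16 (by decide), h11]

section round

variable {O : Oracles N.numE N.numM k} {W : Fin k → Fin N.numM → Bool} {b : Fin N.numM → ℝ}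
  {p R Q : ℝ}

/-- Compute the lengths of the edges from their weights. -/
def lengthsCmd : Cmd :=
  fillR 20 5 edgeCount (.div (.cell 7 (.lit 0) (.var 20)) (.ofNat (.cell 1 (.lit 2) (.var 20))))

theorem runs_lengthsCmd {s : Mem} (h : Ready N W b p R Q s) {y : Fin N.numE → ℝ}
    (hy : ∀ e : Fin N.numE, s.real 7 0 e = y e) :
    Runs O lengthsCmd s (N.numE * 3 + 2) fun s' =>
      Frame [20] [5] s s' ∧ ∀ e : Fin N.numE, s'.real 5 0 e = y e / N.cap e := by
  refine (Runs.fillR (b := edgeCount) N.numE (entry fun e => y e / N.cap e) (fun s' hF => (h.frame hF).numE)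
    fun i hi s' hF hc _ => ?_).mono le_rfl fun s' hs' => ⟨hs'.1, fun e => ?_⟩
  · simp only [RExp.eval, NExp.eval]
    rw [hc, hF.real 7 (by decide), entry_of_lt _ hi, hy ⟨i, hi⟩, (h.frame hF).cap ⟨i, hi⟩]
  · rw [hs'.2 e e.2, entry_fin]

/-- Query the code oracle for the weight vector whose index is in the counter 20. -/
def solveOneCmd : Cmd :=
  .seq (fillN 21 8 (.lit 0) msgCount (.cell 4 (.var 20) (.var 21)))
  (.seq .callCode
  (.seq (fillN 21 12 (.var 20) edgeCount (.cell 10 (.lit 0) (.var 21)))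
  (.seq (sumR 21 3 (.var 20) edgeCount
    (.mul (.ofNat (.cell 12 (.var 20) (.var 21))) (.cell 5 (.lit 0) (.var 21))))
  (.ite (.realLe (.cell 3 (.lit 0) (.var 20)) (.ofNat (.lit 0)))
    (.setR 3 (.lit 0) (.var 20) (.ofNat (.lit 1))) .skip))))

theorem frame_codeStep (s : Mem) : Frame [9, 10] [] s (codeStep O s) := by
  unfold codeStep
  split
  · exact ⟨fun a ha => put_of_ne _ _ _ _ (by rintro rfl; simp at ha), fun _ _ => rfl⟩
  · refine ⟨fun a ha => ?_, fun _ _ => rfl⟩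
    have h9 : a ≠ 9 := by
      rintro rfl
      simp at ha
    have h10 : a ≠ 10 := by
      rintro rfl
      simp at ha
    funext i j
    simp [put, h9, h10]

theorem codeStep_used {s : Mem} {U : Finset (Fin N.numE)}
    (h : O.code (fun m => decide (s.nat 8 0 m ≠ 0)) (fun e => s.real 5 0 e) = some U)
    (e : Fin N.numE) : (codeStep O s).nat 10 0 e = if e ∈ U then 1 else 0 := by
  unfold codeStep
  rw [h]
  simp [put]

/-- The next call overwrites the oracle's answer, so the edge set is saved in row `j` of the natural
array 12. The covering oracle admits only positive costs, so an edge set of length 0 is priced 1. -/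
theorem runs_solveOneCmd {s : Mem} (h : Ready N W b p R Q s) {l : Fin N.numE → ℝ}
    (hl : ∀ e : Fin N.numE, s.real 5 0 e = l e) (j : Fin k) (hj : s.nat 20 0 0 = j)
    {U : Finset (Fin N.numE)} (hU : O.code (W j) l = some U) :
    Runs O solveOneCmd s (3 * N.numM + O.codeTime + 6 * N.numE + 9) fun s' =>
      Frame [8, 9, 10, 12, 21] [3] s s' ∧
      (∀ e : Fin N.numE, s'.nat 12 j e = if e ∈ U then 1 else 0) ∧
      (s'.real 3 0 j = if ∑ e ∈ U, l e ≤ 0 then 1 else ∑ e ∈ U, l e) ∧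
      (∀ i : ℕ, i ≠ j → s'.nat 12 i = s.nat 12 i ∧ s'.real 3 0 i = s.real 3 0 i) := by
  classical
  refine (Runs.seq (Runs.fillN (b := msgCount) (by decide) N.numM 0 (entry fun m => (W j m).toNat)
    (fun s' hF => (h.frame hF).numM) (fun _ _ => rfl) fun i hi s' hF hc => ?_)
    fun s₁ ⟨hF₁, hv₁, _⟩ => Runs.seq (t₁ := O.codeTime) (Runs.callCode (Q := fun s' =>
      Frame [8, 9, 10, 21] [] s s' ∧ ∀ e : Fin N.numE, s'.nat 10 0 e = if e ∈ U then 1 else 0) ?_)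
    fun s₂ ⟨hF₂, hv₂⟩ => Runs.seq (Runs.fillN (b := edgeCount) (by decide) N.numE j
      (entry fun e => if e ∈ U then 1 else 0) (fun s' hF => ((h.frame hF₂).frame hF).numE)
      (fun s' hF => ?_) fun i hi s' hF hc => ?_)
    fun s₃ ⟨hF₃, hv₃, ho₃⟩ => Runs.seq (Runs.sumR (b := edgeCount) N.numE j
      (entry fun e => if e ∈ U then l e else 0)
      (fun s' hF => (((h.frame hF₂).frame hF₃).frame hF).numE) (fun s' hF => ?_)
      fun i hi s' hF hc => ?_)
    fun s₄ ⟨hF₄, hv₄, ho₄⟩ => Runs.ite (t := 1) (fun ht => Runs.setR ?_)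
      fun ht => Runs.skip ?_).mono (by linarith) fun s' hs' => hs'
  · simp only [NExp.eval]
    rw [hc, hF.nat 20 (by decide), hj, (h.frame hF).weight j ⟨i, hi⟩, entry_of_lt _ hi]
  · have hF' : Frame [8, 9, 10, 21] [] s (codeStep O s₁) := hF₁.trans (frame_codeStep s₁)
    have hq : O.code (fun m => decide (s₁.nat 8 0 m ≠ 0)) (fun e => s₁.real 5 0 e) = some U := by
      rw [← hU]
      congr 1
      · funext m
        rw [hv₁ m m.2, entry_fin]
        cases W j m <;> rfl
      · funext e
        rw [hF₁.real 5 (by decide), hl]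
    exact ⟨hF', codeStep_used hq⟩
  · simp only [NExp.eval]
    rw [hF.nat 20 (by decide), hF₂.nat 20 (by decide), hj]
  · simp only [NExp.eval]
    rw [hc, hF.nat 10 (by decide), hv₂ ⟨i, hi⟩, entry_of_lt _ hi]
  · simp only [NExp.eval]
    rw [hF.nat 20 (by decide), hF₃.nat 20 (by decide), hF₂.nat 20 (by decide), hj]
  · simp only [RExp.eval, NExp.eval]
    rw [hc, hF.nat 20 (by decide), hF₃.nat 20 (by decide), hF₂.nat 20 (by decide), hj,
      hF.nat 12 (by decide), hv₃ i hi, hF.real 5 (by decide), hF₃.real 5 (by decide),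
      hF₂.real 5 (by decide), hl ⟨i, hi⟩, entry_of_lt _ hi, entry_of_lt _ hi]
    split_ifs <;> simp
  all_goals
    have hj₄ : s₄.nat 20 0 0 = j := by
      rw [hF₄.nat 20 (by decide), hF₃.nat 20 (by decide), hF₂.nat 20 (by decide), hj]
    have hsum : s₄.real 3 0 j = ∑ e ∈ U, l e := by
      rw [hv₄, sum_range_entry, ← Finset.sum_filter, Finset.filter_mem_eq_inter,
        Finset.univ_inter]
    have hF : Frame [8, 9, 10, 12, 21] [3] s s₄ :=
      (hF₂.trans hF₃ (A'' := [8, 9, 10, 12, 21]) (R'' := [])).trans hF₄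
    have hmat : ∀ e : Fin N.numE, s₄.nat 12 j e = if e ∈ U then 1 else 0 := fun e => by
      rw [hF₄.nat 12 (by decide), hv₃ e e.2, entry_fin]
    have hother : ∀ i : ℕ, i ≠ j → s₄.nat 12 i = s.nat 12 i ∧ s₄.real 3 0 i = s.real 3 0 i := by
      intro i hi
      refine ⟨?_, ?_⟩
      · funext i'
        rw [hF₄.nat 12 (by decide), ho₃ i i' hi, hF₂.nat 12 (by decide)]
      · rw [ho₄ i hi, hF₃.real 3 (by decide), hF₂.real 3 (by decide)]
    simp only [Test.holds, RExp.eval, NExp.eval, hj₄, hsum, Nat.cast_zero] at ht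
  · simp only [RExp.eval, NExp.eval, hj₄, Nat.cast_one]
    refine ⟨hF.trans (frame_put_real s₄ 3 0 j 1), hmat, ?_, fun i hi => ⟨(hother i hi).1, ?_⟩⟩
    · rw [if_pos ht]
      exact put_same _ _ _ _ _
    · exact (put_of_col_ne _ _ _ _ _ _ _ hi).trans (hother i hi).2
  · refine ⟨hF, hmat, ?_, hother⟩
    rw [if_neg ht, hsum]

/-- Query the code oracle for every weight vector. -/
def solveCmd : Cmd := forLoop 20 weightCount solveOneCmd

theorem runs_solveCmd {s : Mem} (hT : 0 ≤ O.codeTime) (h : Ready N W b p R Q s)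
    {l : Fin N.numE → ℝ} (hl : ∀ e : Fin N.numE, s.real 5 0 e = l e)
    {U : Fin k → Finset (Fin N.numE)} (hU : ∀ j, O.code (W j) l = some (U j)) :
    Runs O solveCmd s (k * (3 * N.numM + O.codeTime + 6 * N.numE + 11) + 2) fun s' =>
      Frame [8, 9, 10, 12, 20, 21] [3] s s' ∧
      (∀ (j : Fin k) (e : Fin N.numE), s'.nat 12 j e = if e ∈ U j then 1 else 0) ∧
      ∀ j : Fin k, s'.real 3 0 j = if ∑ e ∈ U j, l e ≤ 0 then 1 else ∑ e ∈ U j, l e := by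
  refine (Runs.forLoop (t := 3 * N.numM + O.codeTime + 6 * N.numE + 9) (fun i s' =>
      Frame [8, 9, 10, 12, 20, 21] [3] s s' ∧ ∀ j : Fin k, (j : ℕ) < i →
      (∀ (e : Fin N.numE), s'.nat 12 j e = if e ∈ U j then 1 else 0) ∧
      s'.real 3 0 j = if ∑ e ∈ U j, l e ≤ 0 then 1 else ∑ e ∈ U j, l e) k (by positivity) ?_ ?_
      ?_).mono (by linarith) fun s' hs' => ⟨hs'.1, fun j => (hs'.2 j j.2).1,
        fun j => (hs'.2 j j.2).2⟩
  · exact ⟨(frame_put_nat s 20 0 0 0).trans (Frame.refl [] [] _), fun j hj => by omega⟩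
  · exact fun i s' hs' => (h.frame hs'.1).numW
  · rintro i hi s' ⟨hF, hj⟩ hc
    refine (runs_solveOneCmd (h.frame hF) (l := l) (fun e => ?_) ⟨i, hi⟩ hc (hU ⟨i, hi⟩)).mono
      le_rfl ?_
    · rw [hF.real 5 (by decide), hl]
    · rintro s'' ⟨h1, h2, h3, h4⟩
      have hput : ∀ v : ℕ, (put s''.nat 20 0 0 v) 12 = s''.nat 12 := fun v =>
        put_of_ne _ _ _ _ (by decide)
      refine ⟨by rw [h1.nat 20 (by decide), hc], (hF.trans h1 (A'' := [8, 9, 10, 12, 20, 21])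
        (R'' := [3])).trans (frame_put_nat _ 20 0 0 (i + 1)), fun j hji => ?_⟩
      simp only [hput]
      by_cases hjj : (j : ℕ) = i
      · obtain rfl : j = ⟨i, hi⟩ := Fin.ext hjj
        exact ⟨h2, h3⟩
      · rw [(h4 j hjj).1, (h4 j hjj).2]
        exact hj j (by omega)

/-- Compute the loads of the edges. -/
def loadsCmd : Cmd :=
  forLoop 20 edgeCount (sumR 21 8 (.var 20) weightCount
    (.mul (.ofNat (.cell 12 (.var 21) (.var 20))) (.cell 4 (.lit 0) (.var 21))))

theorem runs_loadsCmd {s : Mem} (h : Ready N W b p R Q s) {U : Fin k → Finset (Fin N.numE)}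
    (hU : ∀ (j : Fin k) (e : Fin N.numE), s.nat 12 j e = if e ∈ U j then 1 else 0)
    {x : Fin k → ℝ} (hx : ∀ j : Fin k, s.real 4 0 j = x j) :
    Runs O loadsCmd s (N.numE * (k * 3 + 5) + 2) fun s' =>
      Frame [20, 21] [8] s s' ∧
      ∀ e : Fin N.numE, s'.real 8 0 e = ∑ j, if e ∈ U j then x j else 0 := by
  refine (Runs.forLoop (t := k * 3 + 3) (fun i s' =>
      Frame [20, 21] [8] s s' ∧ ∀ e : Fin N.numE, (e : ℕ) < i →
      s'.real 8 0 e = ∑ j, if e ∈ U j then x j else 0) N.numE (by positivity) ?_ ?_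
      ?_).mono (by linarith) fun s' hs' => ⟨hs'.1, fun e => hs'.2 e e.2⟩
  · exact ⟨(frame_put_nat s 20 0 0 0).trans (Frame.refl [] [] _), fun j hj => by omega⟩
  · exact fun i s' hs' => (h.frame hs'.1).numE
  · rintro i hi s' ⟨hF, he⟩ hc
    refine (Runs.sumR (b := weightCount) k i (entry fun j => if (⟨i, hi⟩ : Fin N.numE) ∈ U j then x j else 0)
      (fun s'' hF' => ((h.frame hF).frame hF').numW) (fun s'' hF' => ?_)
      fun j hj s'' hF' hc' => ?_).mono le_rfl ?_
    · simp only [NExp.eval]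
      rw [hF'.nat 20 (by decide), hc]
    · simp only [RExp.eval, NExp.eval]
      rw [hc', hF'.nat 20 (by decide), hc, hF'.nat 12 (by decide), hF.nat 12 (by decide),
        hF'.real 4 (by decide), hF.real 4 (by decide), hU ⟨j, hj⟩ ⟨i, hi⟩, hx ⟨j, hj⟩,
        entry_of_lt _ hj]
      split_ifs <;> simp
    · rintro s'' ⟨h1, h2, h3⟩
      refine ⟨by rw [h1.nat 20 (by decide), hc], (hF.trans h1 (A'' := [20, 21])
        (R'' := [8])).trans (frame_put_nat _ 20 0 0 (i + 1)), fun e hei => ?_⟩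
      by_cases hee : (e : ℕ) = i
      · obtain rfl : e = ⟨i, hi⟩ := Fin.ext hee
        exact h2.trans (sum_range_entry _)
      · exact (h3 e hee).trans (he e (by omega))

theorem frame_coverStep (s : Mem) : Frame [7] [4] s (coverStep O s) := by
  unfold coverStep
  split
  · exact ⟨fun a ha => put_of_ne _ _ _ _ fun h => ha (by simp [h]), fun _ _ => rfl⟩
  · refine ⟨fun a ha => put_of_ne _ _ _ _ fun h => ha (by simp [h]), fun a ha => ?_⟩
    funext i j
    exact dif_neg fun h => ha (by simp [h.1])

theorem coverStep_solution {s : Mem} {x : Fin k → ℝ}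
    (h : O.cover (coverQuery N.numM k s) = some x) (j : Fin k) :
    (coverStep O s).real 4 0 j = x j := by
  simp [coverStep, h]

/-- Compute the bottleneck, increase the amount that is packed, update the weights of the edges and
compute their maximum. -/
def updateCmd : Cmd :=
  .seq (maxR 20 9 edgeCount
    (.div (.cell 8 (.lit 0) (.var 20)) (.ofNat (.cell 1 (.lit 2) (.var 20)))))
  (.seq (.setR 14 (.lit 0) (.lit 0) (.add (.var 14) (.div (.ofNat (.lit 1)) (.var 9))))
  (.seq (fillR 20 7 edgeCount (.mul (.cell 7 (.lit 0) (.var 20)) (.add (.ofNat (.lit 1))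
    (.mul (.div (.ofNat (.lit 1)) (.var 11)) (.div (.div (.cell 8 (.lit 0) (.var 20))
      (.ofNat (.cell 1 (.lit 2) (.var 20)))) (.var 9))))))
  (maxR 20 13 edgeCount (.cell 7 (.lit 0) (.var 20)))))

/-- Only two properties of the bottleneck matter later: it bounds all relative loads, and it is
attained unless it is the start value 0. -/
theorem runs_updateCmd {s : Mem} (h : Ready N W b p R Q s) {y a : Fin N.numE → ℝ}
    (hy : ∀ e : Fin N.numE, s.real 7 0 e = y e) (ha : ∀ e : Fin N.numE, s.real 8 0 e = a e) :
    Runs O updateCmd s (N.numE * 11 + 9) fun s' =>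
      Frame [20] [7, 9, 13, 14] s s' ∧ ∃ ρ : ℝ, (∀ e, a e / N.cap e ≤ ρ) ∧
      (ρ = 0 ∨ ∃ e, a e / N.cap e = ρ) ∧ s'.real 14 0 0 = s.real 14 0 0 + 1 / ρ ∧
      (∀ e : Fin N.numE, s'.real 7 0 e = y e * (1 + 1 / p * (a e / N.cap e / ρ))) ∧
      (∀ e : Fin N.numE, s'.real 7 0 e ≤ s'.real 13 0 0) ∧
      (s'.real 13 0 0 = 0 ∨ ∃ e : Fin N.numE, s'.real 7 0 e = s'.real 13 0 0) := by
  refine (Runs.seq (Runs.maxR (b := edgeCount) N.numE (entry fun e => a e / N.cap e)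
    (fun s' hF => (h.frame hF).numE) fun i hi s' hF hc => ?_) fun s₁ ⟨hF₁, hle₁, hex₁⟩ =>
    Runs.seq (Runs.setR (Q := fun s' => Frame [] [14] s₁ s' ∧
      s'.real 14 0 0 = s.real 14 0 0 + 1 / s₁.real 9 0 0) ⟨frame_put_real _ _ _ _ _, ?_⟩)
    fun s₂ ⟨hF₂, hv₂⟩ => Runs.seq (Runs.fillR (b := edgeCount) N.numE
      (entry fun e => y e * (1 + 1 / p * (a e / N.cap e / s₁.real 9 0 0)))
      (fun s' hF => (((h.frame hF₁).frame hF₂).frame hF).numE) fun i hi s' hF hc hs' => ?_)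
    fun s₃ ⟨hF₃, hv₃⟩ => (Runs.maxR (b := edgeCount) N.numE (s₃.real 7 0)
      (fun s' hF => ((((h.frame hF₁).frame hF₂).frame hF₃).frame hF).numE)
      fun i hi s' hF hc => ?_).mono le_rfl fun s₄ ⟨hF₄, hle₄, hex₄⟩ => ?_).mono (by linarith)
      fun s' hs' => hs'
  · simp only [RExp.eval, NExp.eval]
    rw [hc, hF.real 8 (by decide), entry_of_lt _ hi, ha ⟨i, hi⟩, (h.frame hF).cap ⟨i, hi⟩]
  · simp only [RExp.eval, NExp.eval, Nat.cast_one]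
    rw [hF₁.real 14 (by decide)]
    exact put_same _ _ _ _ _
  · have hr := ((h.frame hF₁).frame hF₂).frame hF
    simp only [RExp.eval, NExp.eval, Nat.cast_one]
    rw [hc, hr.prec, hs', hr.cap ⟨i, hi⟩, hF₂.real 7 (by decide), hF₁.real 7 (by decide),
      hF.real 8 (by decide), hF₂.real 8 (by decide), hF₁.real 8 (by decide),
      hF.real 9 (by decide), hF₂.real 9 (by decide), hy ⟨i, hi⟩, ha ⟨i, hi⟩, entry_of_lt _ hi]
  · simp only [RExp.eval, NExp.eval]
    rw [hc, hF.real 7 (by decide)]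
  · have h7 : s₄.real 7 = s₃.real 7 := hF₄.real 7 (by decide)
    rw [h7]
    refine ⟨((hF₁.trans hF₂ (A'' := [20]) (R'' := [9, 14])).trans hF₃ (A'' := [20])
      (R'' := [7, 9, 14])).trans hF₄, s₁.real 9 0 0, fun e => ?_, ?_, ?_, fun e => ?_,
      fun e => hle₄ e e.2, ?_⟩
    · have := hle₁ e e.2
      rwa [entry_fin] at this
    · refine hex₁.imp id ?_
      rintro ⟨i, hi, h'⟩
      rw [entry_of_lt _ hi] at h'
      exact ⟨_, h'⟩
    · rw [hF₄.real 14 (by decide), hF₃.real 14 (by decide), hv₂]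
    · rw [hv₃ e e.2, entry_fin]
    · exact hex₄.imp id fun ⟨i, hi, h'⟩ => ⟨⟨i, hi⟩, h'⟩

/-- One round of the iteration. -/
def roundCmd : Cmd :=
  .seq lengthsCmd (.seq solveCmd (.seq .callCover (.seq loadsCmd updateCmd)))

end round

end OracleRAM

/-! ### Correctness of one round -/

namespace OracleRAM

variable {N : CapNetwork} {F : Type*} [Field F] {k : ℕ} {O : Oracles N.numE N.numM k}
  {W : Fin k → Fin N.numM → Bool} {b : Fin N.numM → ℝ} {p Q : ℕ} {B lam : ℝ}

/-- The invariant of the main loop after `i` rounds. -/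
structure MainInvariant (N : CapNetwork) (F : Type*) [Field F] (W : Fin k → Fin N.numM → Bool)
    (b : Fin N.numM → ℝ) (p Q : ℕ) (B lam : ℝ) (i : ℕ) (s : Mem) : Prop where
  ready : Ready N W b p ((1 + 1 / (p : ℝ)) ^ (Q - 1)) Q s
  packing : N.PackingInvariant F b (1 / p) B lam i (s.real 14 0 0) fun e => s.real 7 0 e
  le_pow : ∀ e : Fin N.numE, s.real 7 0 e ≤ (1 + 1 / (p : ℝ)) ^ Q
  le_max : ∀ e : Fin N.numE, s.real 7 0 e ≤ s.real 13 0 0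
  max_eq : ∃ e : Fin N.numE, s.real 7 0 e = s.real 13 0 0

theorem exists_code_answer (hO : N.IsExactCodeOracle F O.code) {w : Fin N.numM → Bool}
    (hw : N.IsWeightVector F w) {l : Fin N.numE → ℝ} (hl : ∀ e, 0 ≤ l e) :
    ∃ U, O.code w l = some U ∧ N.IsSolvable F w U ∧
      ∀ V, N.IsSolvable F w V → ∑ e ∈ U, l e ≤ ∑ e ∈ V, l e := by
  have h := hO w l hl
  cases hc : O.code w l with
  | none =>
    rw [hc] at h
    exact absurd hw h
  | some U =>
    rw [hc] at h
    obtain ⟨P, hP, hU, hmin⟩ := h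
    refine ⟨U, rfl, ⟨P, hP, hU.symm⟩, ?_⟩
    rintro V ⟨P', hP', rfl⟩
    exact hmin P' hP'

theorem sum_toNat_mul (v : Fin k → Bool) (x : Fin k → ℝ) :
    ∑ j, (((v j).toNat : ℕ) : ℝ) * x j = ∑ j, if v j = true then x j else 0 :=
  Finset.sum_congr rfl fun j _ => by cases v j <;> simp

/-- The answer of the covering oracle to a query with the transposed weight vectors and the upper
bounds 1. -/
theorem exists_cover_answer (hO : CoverInstance.IsApproxOracle B O.cover)
    {I : CoverInstance N.numM k} (hA : ∀ m j, I.A m j = (W j m).toNat) (hu : ∀ j, I.u j = 1)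
    (hb : ∀ m, 0 ≤ I.b m) (hc : ∀ j, 0 < I.c j) {x₀ : Fin k → ℝ} (hx₀ : ∀ j, 0 ≤ x₀ j ∧ x₀ j ≤ 1)
    (hcov : ∀ m, I.b m ≤ ∑ j, if W j m = true then x₀ j else 0) :
    ∃ x : Fin k → ℝ, O.cover I = some x ∧ (∀ j, 0 ≤ x j) ∧
      (∀ m, I.b m ≤ ∑ j, if W j m = true then x j else 0) ∧
      ∀ x' : Fin k → ℝ, (∀ j, 0 ≤ x' j ∧ x' j ≤ 1) →
        (∀ m, I.b m ≤ ∑ j, if W j m = true then x' j else 0) →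
        ∑ j, I.c j * x j ≤ B * ∑ j, I.c j * x' j := by
  have hf : ∀ x : Fin k → ℝ, I.Feasible x ↔
      (∀ m, I.b m ≤ ∑ j, if W j m = true then x j else 0) ∧ ∀ j, 0 ≤ x j ∧ x j ≤ 1 := by
    intro x
    simp only [CoverInstance.Feasible, hA, hu, sum_toNat_mul (fun j => W j _), Nat.cast_one]
  have h := hO I ⟨hb, hc⟩
  cases hI : O.cover I with
  | none =>
    rw [hI] at h
    exact absurd ((hf x₀).2 ⟨hcov, hx₀⟩) (h x₀)
  | some x =>
    rw [hI] at h
    obtain ⟨h1, h2⟩ := h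
    rw [hf] at h1
    exact ⟨x, rfl, fun j => (h1.2 j).1, h1.1, fun x' hx' hb' => h2 x' ((hf x').2 ⟨hb', hx'⟩)⟩

/-- Neither oracle can report failure: the code queries are for weight vectors, and duality provides
a cover within the unit box. The memory contents then match the hypotheses of
`PackingInvariant.step`. -/
theorem runs_roundCmd (hN : N.Nondegenerate) (hd : ∀ m, ∃ x, m ∈ N.rcv x)
    (hcover : CoverInstance.IsApproxOracle B O.cover) (hcode : N.IsExactCodeOracle F O.code)
    (hT : 0 ≤ O.codeTime) (hinj : Function.Injective W) (hW : ∀ j, N.IsWeightVector F (W j))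
    (hsurj : ∀ w, N.IsWeightVector F w → ∃ j, W j = w) (hb0 : ∀ m, 0 ≤ b m) (hb1 : ∀ m, b m ≤ 1)
    (hb : ∃ m, 0 < b m) (hp : 0 < p) (hQ : 0 < Q) (hB : 0 ≤ B) (hlam : 0 < lam)
    (hpack : N.Packs F (fun m => lam * b m) (fun e => N.cap e)) {i : ℕ} {s : Mem}
    (h : MainInvariant N F W b p Q B lam i s) (hs : s.real 13 0 0 < s.real 12 0 0) :
    Runs O roundCmd s (3 * (k * N.numM) + k * O.codeTime + 9 * (k * N.numE) + 11 * k +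
      19 * N.numE + 15 + O.coverTime) (MainInvariant N F W b p Q B lam (i + 1)) := by
  classical
  have hε : (0 : ℝ) < 1 / p := by positivity
  let y : Fin N.numE → ℝ := fun e => s.real 7 0 e
  let l : Fin N.numE → ℝ := fun e => y e / N.cap e
  have hl : ∀ e, 0 < l e := fun e => div_pos (one_pos.trans_le (h.packing.one_le e))
    (by exact_mod_cast N.cap_pos e)
  choose U hU hUs hUmin using fun j => exists_code_answer (l := l) hcode (hW j) fun e => (hl e).le
  let cost : Fin k → ℝ := fun j => if ∑ e ∈ U j, l e ≤ 0 then 1 else ∑ e ∈ U j, l e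
  have hcost : ∀ j, 0 < cost j := fun j => by
    simp only [cost]
    split_ifs with h'
    · exact one_pos
    · exact not_le.1 h'
  obtain ⟨x₀, hx₀, hx₀b, -⟩ := CapNetwork.exists_cheap_cover hN hd hinj hsurj hb1 hlam hpack hl hUs
    hUmin (cost := cost) fun j => rfl
  refine (Runs.seq (runs_lengthsCmd h.ready (y := y) fun e => rfl) fun s₁ ⟨hF₁, hl₁⟩ =>
    Runs.seq (runs_solveCmd hT (h.ready.frame hF₁) hl₁ hU) fun s₂ ⟨hF₂, hU₂, hc₂⟩ => ?_).mono
    (t := (N.numE * 3 + 2) + ((k * (3 * N.numM + O.codeTime + 6 * N.numE + 11) + 2) +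
      (O.coverTime + ((N.numE * (k * 3 + 5) + 2) + (N.numE * 11 + 9))))) (by linarith)
      fun s' hs' => hs'
  have hr₂ := (h.ready.frame hF₁).frame hF₂
  have hIb : ∀ m, (coverQuery N.numM k s₂).b m = b m := hr₂.demand
  have hIc : ∀ j, (coverQuery N.numM k s₂).c j = cost j := hc₂
  obtain ⟨x, hx, hx0, hxb, hopt⟩ := exists_cover_answer hcover (I := coverQuery N.numM k s₂)
    (W := W) hr₂.matrix hr₂.bound (fun m => by rw [hIb]; exact hb0 m)
    (fun j => by rw [hIc]; exact hcost j) hx₀ (fun m => by rw [hIb]; exact hx₀b m)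
  simp only [hIb, hIc] at hxb hopt
  refine Runs.seq (Runs.callCover (Q := fun s' => Frame [7] [4] s₂ s' ∧
    ∀ j : Fin k, s'.real 4 0 j = x j) ⟨frame_coverStep s₂, coverStep_solution hx⟩)
    fun s₃ ⟨hF₃, hx₃⟩ => ?_
  have hr₃ := hr₂.frame hF₃
  refine Runs.seq (runs_loadsCmd hr₃ (U := U) (fun j e => ?_) hx₃) fun s₄ ⟨hF₄, ha₄⟩ => ?_
  · rw [hF₃.nat 12 (by decide), hU₂]
  have hr₄ := hr₃.frame hF₄
  refine (runs_updateCmd hr₄ (y := y) (fun e => ?_) ha₄).mono le_rfl ?_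
  · rw [hF₄.real 7 (by decide), hF₃.real 7 (by decide), hF₂.real 7 (by decide),
      hF₁.real 7 (by decide)]
  rintro s₅ ⟨hF₅, ρ, hρ, hρ', hf, hy, hmax, hmax'⟩
  obtain ⟨hstep, hle⟩ := h.packing.step hN hd hinj hsurj hb1 hb hε hB hlam hpack (l := l)
    (fun e => rfl) hUs hUmin (cost := cost) (fun j => rfl) hx0 hxb hopt (fun e => rfl) hρ hρ'
  have hf₄ : s₄.real 14 0 0 = s.real 14 0 0 := by
    rw [hF₄.real 14 (by decide), hF₃.real 14 (by decide), hF₂.real 14 (by decide),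
      hF₁.real 14 (by decide)]
  rw [hf₄] at hf
  refine ⟨hr₄.frame hF₅, ?_, fun e => ?_, hmax, ?_⟩
  · simp only [hf, hy]
    exact hstep
  · rw [hy]
    refine (hle e).trans ?_
    -- The round began with all weights below the threshold `(1 + ε) ^ (Q - 1)`, so one more factor
    -- `1 + ε` stays within `(1 + ε) ^ Q`.
    have h1 : s.real 7 0 e ≤ (1 + 1 / (p : ℝ)) ^ (Q - 1) := by
      rw [← h.ready.thr]
      exact (h.le_max e).trans hs.le
    refine (mul_le_mul_of_nonneg_right h1 (by positivity)).trans_eq ?_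
    rw [← pow_succ]
    congr 1
    omega
  -- The weights are at least 1, so their maximum is not the start value 0.
  · rcases hmax' with h0 | h0
    · obtain ⟨e, -⟩ := h.max_eq
      have h1 := hstep.one_le e
      have h2 := hmax e
      rw [h0, hy] at h2
      have : (1 : ℝ) ≤ 0 := h1.trans h2
      linarith
    · exact h0

end OracleRAM

/-! ### Initialization and the whole program -/

namespace OracleRAM

variable {N : CapNetwork} {F : Type*} [Field F] {k : ℕ} {O : Oracles N.numE N.numM k}
  {W : Fin k → Fin N.numM → Bool}

/-- Write down the covering problem (without its costs) with the right-hand side scaled to maximum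
1, and set the weights of the edges to 1. -/
def coverSetupCmd : Cmd :=
  .seq (maxR 20 10 msgCount (.cell 1 (.lit 0) (.var 20)))
  (.seq (fillR 20 2 msgCount (.div (.cell 1 (.lit 0) (.var 20)) (.var 10)))
  (.seq (fillN 20 6 (.lit 0) weightCount (.lit 1))
  (.seq (forLoop 20 msgCount (fillN 21 5 (.var 20) weightCount (.cell 4 (.var 21) (.var 20))))
  (.seq (fillR 20 7 edgeCount (.ofNat (.lit 1)))
  (.setR 13 (.lit 0) (.lit 0) (.ofNat (.lit 1)))))))

/-- Division by the largest entry makes the demands at most 1, which is what lets the bounds `x ≤ 1`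
do no harm. The matrix is the transposed list of weight vectors. -/
theorem runs_coverSetupCmd {s : Mem} (hE : s.nat 0 0 1 = N.numE) (hM : s.nat 0 0 2 = N.numM)
    (hk : s.nat 0 0 3 = k)
    (hW : ∀ (j : Fin k) (m : Fin N.numM), s.nat 4 j m = (W j m).toNat)
    {q : Fin N.numM → ℝ} (hq : ∀ m : Fin N.numM, s.real 1 0 m = q m) :
    Runs O coverSetupCmd s (11 * N.numM + 3 * k + 3 * (N.numM * k) + 3 * N.numE + 12) fun s' =>
      Frame [5, 6, 20, 21] [2, 7, 10, 13] s s' ∧ (∃ Z : ℝ, (∀ m, q m ≤ Z) ∧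
        (Z = 0 ∨ ∃ m, q m = Z) ∧ ∀ m : Fin N.numM, s'.real 2 0 m = q m / Z) ∧
      (∀ (m : Fin N.numM) (j : Fin k), s'.nat 5 m j = (W j m).toNat) ∧
      (∀ j : Fin k, s'.nat 6 0 j = 1) ∧ (∀ e : Fin N.numE, s'.real 7 0 e = 1) ∧
      s'.real 13 0 0 = 1 := by
  have h0 : ∀ {s₁ s₂ : Mem} {A R : List ℕ} (j : ℕ), Frame A R s₁ s₂ → 0 ∉ A →
      s₂.nat 0 0 j = s₁.nat 0 0 j := fun j hF hA => by rw [hF.nat 0 hA]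
  refine (Runs.seq (Runs.maxR (b := msgCount) N.numM (entry q)
    (fun s' hF => (h0 2 hF (by decide)).trans hM) fun i hi s' hF hc => ?_)
    fun s₁ ⟨hF₁, hle₁, hex₁⟩ => Runs.seq (Runs.fillR (b := msgCount) N.numM
      (entry fun m => q m / s₁.real 10 0 0)
      (fun s' hF => ((h0 2 hF (by decide)).trans (h0 2 hF₁ (by decide))).trans hM)
      fun i hi s' hF hc _ => ?_)
    fun s₂ ⟨hF₂, hv₂⟩ => Runs.seq (Runs.fillN (b := weightCount) (by decide) k 0 (fun _ => 1)
      (fun s' hF => (((h0 3 hF (by decide)).trans (h0 3 hF₂ (by decide))).trans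
        (h0 3 hF₁ (by decide))).trans hk) (fun _ _ => rfl) fun _ _ _ _ _ => rfl)
    fun s₃ ⟨hF₃, hv₃, _⟩ => Runs.seq (Runs.forLoop (b := msgCount) (t := k * 3 + 2) (fun i s' =>
      Frame [5, 20, 21] [] s₃ s' ∧ ∀ m : Fin N.numM, (m : ℕ) < i → ∀ j : Fin k,
        s'.nat 5 m j = (W j m).toNat) N.numM (by positivity) ?_ ?_ ?_)
    fun s₄ ⟨hF₄, hv₄⟩ => Runs.seq (Runs.fillR (b := edgeCount) N.numE (fun _ => 1)
      (fun s' hF => (((((h0 1 hF (by decide)).trans (h0 1 hF₄ (by decide))).trans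
        (h0 1 hF₃ (by decide))).trans (h0 1 hF₂ (by decide))).trans
        (h0 1 hF₁ (by decide))).trans hE) fun _ _ _ _ _ _ => by simp [RExp.eval, NExp.eval])
    fun s₅ ⟨hF₅, hv₅⟩ => Runs.setR ?_).mono (by linarith) fun s' hs' => hs'
  · simp only [RExp.eval, NExp.eval]
    rw [hc, hF.real 1 (by decide), hq ⟨i, hi⟩, entry_of_lt _ hi]
  · simp only [RExp.eval, NExp.eval]
    rw [hc, hF.real 1 (by decide), hF.real 10 (by decide), hF₁.real 1 (by decide), hq ⟨i, hi⟩,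
      entry_of_lt _ hi]
  · exact ⟨(frame_put_nat s₃ 20 0 0 0).trans (Frame.refl [] [] _), fun j hj => by omega⟩
  · intro i s' hs'
    exact ((((h0 2 hs'.1 (by decide)).trans (h0 2 hF₃ (by decide))).trans
      (h0 2 hF₂ (by decide))).trans (h0 2 hF₁ (by decide))).trans hM
  · rintro i hi s' ⟨hF, hm⟩ hc
    refine (Runs.fillN (b := weightCount) (by decide) k i (entry fun j => (W j ⟨i, hi⟩).toNat)
      (fun s'' hF' => (((((h0 3 hF' (by decide)).trans (h0 3 hF (by decide))).trans
        (h0 3 hF₃ (by decide))).trans (h0 3 hF₂ (by decide))).trans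
        (h0 3 hF₁ (by decide))).trans hk) (fun s'' hF' => ?_) fun j hj s'' hF' hc' => ?_).mono
      le_rfl ?_
    · simp only [NExp.eval]
      rw [hF'.nat 20 (by decide), hc]
    · simp only [NExp.eval]
      rw [hc', hF'.nat 20 (by decide), hc, hF'.nat 4 (by decide), hF.nat 4 (by decide),
        hF₃.nat 4 (by decide), hF₂.nat 4 (by decide), hF₁.nat 4 (by decide), hW ⟨j, hj⟩ ⟨i, hi⟩,
        entry_of_lt _ hj]
    · rintro s'' ⟨h1, h2, h3⟩
      have hput : (put s''.nat 20 0 0 (i + 1)) 5 = s''.nat 5 := put_of_ne _ _ _ _ (by decide)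
      refine ⟨by rw [h1.nat 20 (by decide), hc], (hF.trans h1 (A'' := [5, 20, 21])
        (R'' := [])).trans (frame_put_nat _ 20 0 0 (i + 1)), fun m hmi j => ?_⟩
      simp only [hput]
      by_cases hmm : (m : ℕ) = i
      · obtain rfl : m = ⟨i, hi⟩ := Fin.ext hmm
        rw [h2 j j.2, entry_fin]
      · rw [h3 m j hmm]
        exact hm m (by omega) j
  · have hF : Frame [5, 6, 20, 21] [2, 7, 10] s s₅ :=
      (((hF₁.trans hF₂ (A'' := [20]) (R'' := [2, 10])).trans hF₃ (A'' := [6, 20])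
        (R'' := [2, 10])).trans hF₄ (A'' := [5, 6, 20, 21]) (R'' := [2, 10])).trans hF₅
    have hp : ∀ a, a ≠ 13 → ∀ i j v, put s₅.real 13 i j v a = s₅.real a := fun a ha i j v =>
      put_of_ne _ _ _ _ ha
    refine ⟨hF.trans (frame_put_real _ _ _ _ _), ⟨s₁.real 10 0 0, fun m => ?_, ?_, fun m => ?_⟩,
      fun m j => ?_, fun j => ?_, fun e => ?_, ?_⟩
    · have := hle₁ m m.2
      rwa [entry_fin] at this
    · refine hex₁.imp id ?_
      rintro ⟨i, hi, h'⟩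
      rw [entry_of_lt _ hi] at h'
      exact ⟨_, h'⟩
    · dsimp only
      rw [hp 2 (by decide), hF₅.real 2 (by decide), hF₄.real 2 (by decide), hF₃.real 2 (by decide), hv₂ m m.2,
        entry_fin]
    · rw [hF₅.nat 5 (by decide), hv₄ m m.2]
    · rw [hF₅.nat 6 (by decide), hF₄.nat 6 (by decide), hv₃ j j.2]
    · dsimp only
      rw [hp 7 (by decide), hv₅ e e.2]
    · simp [RExp.eval, NExp.eval, put]

/-- Compute the smallest natural number that is at least `5 / ω`. -/
def precisionCmd : Cmd :=
  .seq (.setR 11 (.lit 0) (.lit 0) (.ofNat (.lit 1)))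
    (.loop (.realLt (.mul (.var 11) (.var 0)) (.ofNat (.lit 5)))
      (.setR 11 (.lit 0) (.lit 0) (.add (.var 11) (.ofNat (.lit 1)))))

/-- Reals cannot be rounded, so `p` is found by counting upwards; `O(1 / ω)` steps are affordable.
-/
theorem runs_precisionCmd {s : Mem} {ω : ℝ} (hω : 0 < ω) (hs : s.real 0 0 0 = ω) :
    Runs O precisionCmd s (2 * ⌈5 / ω⌉₊ + 2) fun s' =>
      Frame [] [11] s s' ∧ s'.real 11 0 0 = ⌈5 / ω⌉₊ := by
  have h1 : 1 ≤ ⌈5 / ω⌉₊ := Nat.one_le_ceil_iff.2 (by positivity)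
  refine (Runs.seq (Runs.setR rfl) fun s₁ hs₁ => Runs.loop (t := 1) (fun i s' =>
    Frame [] [11] s s' ∧ s'.real 11 0 0 = (i + 1 : ℕ) ∧ i + 1 ≤ ⌈5 / ω⌉₊) ⌈5 / ω⌉₊ zero_le_one ?_
    ?_).mono (by linarith) ?_
  · rintro i s' ⟨hF, hi, hn⟩ ht
    simp only [Test.holds, RExp.eval, NExp.eval] at ht
    rw [hi, hF.real 0 (by decide), hs, ← lt_div_iff₀ hω] at ht
    have hlt : i + 1 < ⌈5 / ω⌉₊ := Nat.lt_ceil.2 (by exact_mod_cast ht)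
    refine ⟨by omega, Runs.setR ⟨hF.trans (frame_put_real _ _ _ _ _), ?_, hlt⟩⟩
    simp [RExp.eval, NExp.eval, put, hi]
  · subst hs₁
    refine ⟨frame_put_real _ _ _ _ _, ?_, by omega⟩
    simp [RExp.eval, NExp.eval, put]
  · rintro s' ⟨⟨i, -, hF, hi, hn⟩, ht⟩
    refine ⟨hF, ?_⟩
    simp only [Test.holds, RExp.eval, NExp.eval] at ht
    rw [hi, hF.real 0 (by decide), hs, ← lt_div_iff₀ hω, not_lt] at ht
    have := Nat.ceil_le.2 (by exact_mod_cast ht : 5 / ω ≤ (i + 1 : ℕ))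
    rw [hi, le_antisymm hn this]

/-- Compute the binary logarithm of the number of edges, rounded up and at least 1. -/
def logCmd : Cmd :=
  .seq (.setR 15 (.lit 0) (.lit 0) (.ofNat (.lit 2)))
  (.seq (.setR 18 (.lit 0) (.lit 0) (.ofNat (.lit 1)))
  (.loop (.realLt (.var 15) (.ofNat edgeCount))
    (.seq (.setR 15 (.lit 0) (.lit 0) (.add (.var 15) (.var 15)))
      (.setR 18 (.lit 0) (.lit 0) (.add (.var 18) (.ofNat (.lit 1)))))))

/-- Doubling starts at 2 with exponent 1, so the result is positive even for a single edge. -/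
theorem runs_logCmd {s : Mem} {n : ℕ} (hs : s.nat 0 0 1 = n) :
    Runs O logCmd s (3 * (max 1 (Nat.clog 2 n) : ℕ) + 3) fun s' =>
      Frame [] [15, 18] s s' ∧ s'.real 18 0 0 = (max 1 (Nat.clog 2 n) : ℕ) := by
  set g := max 1 (Nat.clog 2 n) with hg
  refine (Runs.seq (Runs.setR rfl) fun s₁ hs₁ => Runs.seq (Runs.setR rfl) fun s₂ hs₂ =>
    Runs.loop (t := 2) (fun i s' => Frame [] [15, 18] s s' ∧ s'.real 15 0 0 = (2 ^ (i + 1) : ℕ) ∧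
      s'.real 18 0 0 = (i + 1 : ℕ) ∧ i + 1 ≤ g) g zero_le_two ?_
    ?_).mono (by linarith) ?_
  · rintro i s' ⟨hF, hD, hi, hn⟩ ht
    simp only [Test.holds, RExp.eval, NExp.eval] at ht
    rw [hD, hF.nat 0 (by decide), hs, Nat.cast_lt] at ht
    have hlt : i + 1 < Nat.clog 2 n := (Nat.lt_clog_iff_pow_lt one_lt_two).2 ht
    have hlt' : i + 1 < g := hlt.trans_le (le_max_right _ _)
    refine ⟨by omega, (Runs.seq (Runs.setR rfl) fun s₃ hs₃ => Runs.setR ?_).mono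
      (t := 1 + 1) (by norm_num) fun _ h => h⟩
    subst hs₃
    refine ⟨(hF.trans (frame_put_real _ _ _ _ _) (A'' := []) (R'' := [15, 18])).trans
      (frame_put_real _ _ _ _ _), ?_, ?_, hlt'⟩
    · simp only [RExp.eval, NExp.eval, put, hD]
      simp
      ring
    · simp only [RExp.eval, NExp.eval, put, hi]
      simp
  · subst hs₁
    subst hs₂
    refine ⟨(frame_put_real _ _ _ _ _).trans (frame_put_real _ _ _ _ _), ?_, ?_,
      le_max_left _ _⟩
    · simp [RExp.eval, NExp.eval, put]
    · simp [RExp.eval, NExp.eval, put]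
  · rintro s' ⟨⟨i, -, hF, hD, hi, hn⟩, ht⟩
    refine ⟨hF, ?_⟩
    simp only [Test.holds, RExp.eval, NExp.eval] at ht
    rw [hD, hF.nat 0 (by decide), hs, Nat.cast_lt, not_lt] at ht
    have h1 : Nat.clog 2 n ≤ i + 1 := Nat.clog_le_of_le_pow ht
    rw [hi, le_antisymm hn (max_le (by omega) h1)]

/-- Compute the denominator and the threshold for the weights. -/
def thresholdCmd : Cmd :=
  .seq (.setR 16 (.lit 0) (.lit 0) (.mul (.mul (.var 11) (.var 11)) (.var 18)))
  (.seq (.setR 12 (.lit 0) (.lit 0) (.ofNat (.lit 1)))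
  (.seq (.setR 17 (.lit 0) (.lit 0) (.ofNat (.lit 1)))
  (.loop (.realLt (.var 17) (.var 16))
    (.seq (.setR 12 (.lit 0) (.lit 0) (.mul (.var 12)
      (.add (.ofNat (.lit 1)) (.div (.ofNat (.lit 1)) (.var 11)))))
    (.setR 17 (.lit 0) (.lit 0) (.add (.var 17) (.ofNat (.lit 1))))))))

/-- The counter starts at 1 while the power starts at exponent 0, so the loop ends with the exponent
`Q - 1`. -/
theorem runs_thresholdCmd {s : Mem} {p g : ℕ} (hp : s.real 11 0 0 = p) (hg : s.real 18 0 0 = g)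
    (hQ : 0 < p * p * g) :
    Runs O thresholdCmd s (3 * (p * p * g : ℕ) + 4) fun s' =>
      Frame [] [12, 16, 17] s s' ∧ s'.real 16 0 0 = (p * p * g : ℕ) ∧
      s'.real 12 0 0 = (1 + 1 / (p : ℝ)) ^ (p * p * g - 1) := by
  set Q := p * p * g with hQdef
  refine (Runs.seq (Runs.setR rfl) fun s₁ hs₁ => Runs.seq (Runs.setR rfl) fun s₂ hs₂ =>
    Runs.seq (Runs.setR rfl) fun s₃ hs₃ => Runs.loop (t := 2) (fun i s' =>
      Frame [] [12, 16, 17] s s' ∧ s'.real 16 0 0 = (Q : ℕ) ∧ s'.real 17 0 0 = (i + 1 : ℕ) ∧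
      s'.real 12 0 0 = (1 + 1 / (p : ℝ)) ^ i ∧ i + 1 ≤ Q) Q zero_le_two ?_
    ?_).mono (by linarith) ?_
  · rintro i s' ⟨hF, hD, hi, hR, hn⟩ ht
    simp only [Test.holds, RExp.eval, NExp.eval] at ht
    rw [hD, hi, Nat.cast_lt] at ht
    have hp' : s'.real 11 0 0 = p := by rw [hF.real 11 (by decide), hp]
    refine ⟨by omega, (Runs.seq (Runs.setR rfl) fun s₃ hs₃ => Runs.setR ?_).mono
      (t := 1 + 1) (by norm_num) fun _ h => h⟩
    subst hs₃
    refine ⟨(hF.trans (frame_put_real _ _ _ _ _) (A'' := []) (R'' := [12, 16, 17])).trans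
      (frame_put_real _ _ _ _ _), ?_, ?_, ?_, ht⟩
    · simp [NExp.eval, put, hD]
    · simp [RExp.eval, NExp.eval, put, hi]
    · simp [RExp.eval, NExp.eval, put, hR, hp', pow_succ]
  · subst hs₁
    subst hs₂
    subst hs₃
    refine ⟨((frame_put_real _ _ _ _ _).trans (frame_put_real _ _ _ _ _) (A'' := [])
      (R'' := [12, 16])).trans (frame_put_real _ _ _ _ _), ?_, ?_, ?_, hQ⟩
    · simp [RExp.eval, NExp.eval, put, hp, hg, hQdef]
    · simp [RExp.eval, NExp.eval, put]
    · simp [RExp.eval, NExp.eval, put]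
  · rintro s' ⟨⟨i, -, hF, hD, hi, hR, hn⟩, ht⟩
    simp only [Test.holds, RExp.eval, NExp.eval] at ht
    rw [hD, hi, Nat.cast_lt] at ht
    obtain rfl : i = Q - 1 := by omega
    exact ⟨hF, hD, hR⟩

/-- The program of the ray computation. -/
def rayCmd : Cmd :=
  .seq coverSetupCmd (.seq precisionCmd (.seq logCmd (.seq thresholdCmd
    (.seq (.loop (.realLt (.var 13) (.var 12)) roundCmd)
      (fillR 20 6 msgCount (.mul (.div (.var 14) (.var 16)) (.cell 2 (.lit 0) (.var 20))))))))

/-- The iteration runs for `b = q / Z`, whose largest multiple in the region is `lam * Z`. The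
output `f / Q * b` is the multiple `f / (Q * Z)` of `q`, and both bounds scale back by `Z`. -/
theorem runs_rayCmd (hN : N.Nondegenerate) (hd : ∀ m, ∃ x, m ∈ N.rcv x) {B ω lam : ℝ}
    (hcover : CoverInstance.IsApproxOracle B O.cover) (hcode : N.IsExactCodeOracle F O.code)
    (hT : 0 ≤ O.codeTime) (hT' : 0 ≤ O.coverTime) (hinj : Function.Injective W)
    (hW : ∀ j, N.IsWeightVector F (W j)) (hsurj : ∀ w, N.IsWeightVector F w → ∃ j, W j = w)
    (hE : 0 < N.numE) (hB : 0 < B) (hω : 0 < ω) (hω1 : ω ≤ 1)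
    {q : Fin N.numM → ℝ} (hq : ∀ m, 0 ≤ q m) (hq0 : q ≠ 0) (hlam : 0 < lam)
    (hgreat : IsGreatest {x : ℝ | x • q ∈ N.semiRegion F} lam) {p g Q : ℕ} (hp : p = ⌈5 / ω⌉₊)
    (hg : g = max 1 (Nat.clog 2 N.numE)) (hQ : Q = p * p * g) :
    Runs O rayCmd (initMem N W ω B q)
      ((11 * N.numM + 3 * k + 3 * (N.numM * k) + 3 * N.numE + 12) + ((2 * p + 2) + ((3 * g + 3) +
      ((3 * Q + 4) + (((Q * N.numE : ℕ) * (3 * (k * N.numM) + k * O.codeTime + 9 * (k * N.numE) +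
      11 * k + 19 * N.numE + 15 + O.coverTime + 1) + 1) + (N.numM * 3 + 2)))))) fun s =>
      ∃ c : ℝ, output N.numM s = c • q ∧ c ≤ lam ∧ lam ≤ (1 + ω) * B * c := by
  have hpω : 5 ≤ p * ω := by
    rw [← div_le_iff₀ hω, hp]
    exact Nat.le_ceil _
  have hp0 : 0 < p := by
    rw [hp]
    exact Nat.ceil_pos.2 (by positivity)
  have hg0 : 1 ≤ g := hg ▸ le_max_left _ _
  have hgE : N.numE ≤ 2 ^ g := (Nat.le_pow_clog one_lt_two _).trans
    (Nat.pow_le_pow_right two_pos (hg ▸ le_max_right _ _))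
  have hQ0 : 0 < Q := by
    rw [hQ]
    positivity
  have hε : (0 : ℝ) < 1 / p := by positivity
  obtain ⟨m₀, hm₀⟩ := Function.ne_iff.1 hq0
  have hm₀ : 0 < q m₀ := lt_of_le_of_ne (hq m₀) (Ne.symm hm₀)
  refine Runs.seq (runs_coverSetupCmd (W := W) (q := q) (by simp [initMem, entry])
    (by simp [initMem, entry]) (by simp [initMem, entry]) (fun j m => ?_) fun m => ?_)
    fun s₁ ⟨hF₁, ⟨Z, hqZ, hZ, hb₁⟩, hA₁, hu₁, hy₁, hY₁⟩ => ?_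
  · simp only [initMem, entry_fin]
  · simp only [initMem, entry_fin, if_true]
  have hZ0 : 0 < Z := hm₀.trans_le (hqZ m₀)
  let b : Fin N.numM → ℝ := fun m => q m / Z
  refine Runs.seq ((runs_precisionCmd hω ?_).mono (by rw [← hp]) fun _ h => h) fun s₂ ⟨hF₂, hp₂⟩ => ?_
  · rw [hF₁.real 0 (by decide)]
    simp [initMem, entry]
  rw [← hp] at hp₂
  refine Runs.seq ((runs_logCmd (n := N.numE) ?_).mono (by rw [← hg]) fun _ h => h)
    fun s₃ ⟨hF₃, hg₃⟩ => ?_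
  · rw [hF₂.nat 0 (by decide), hF₁.nat 0 (by decide)]
    simp [initMem, entry]
  rw [← hg] at hg₃
  refine Runs.seq ((runs_thresholdCmd (p := p) (g := g) ?_ hg₃ (hQ ▸ hQ0)).mono (by rw [hQ])
    fun _ h => h) fun s₄ ⟨hF₄, hQ₄, hR₄⟩ => ?_
  · rw [hF₃.real 11 (by decide), hp₂]
  rw [← hQ] at hQ₄ hR₄
  have hF : Frame [5, 6, 20, 21] [2, 7, 10, 11, 12, 13, 15, 16, 17, 18] (initMem N W ω B q) s₄ :=
    ((hF₁.trans hF₂ (A'' := [5, 6, 20, 21]) (R'' := [2, 7, 10, 11, 13])).trans hF₃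
      (A'' := [5, 6, 20, 21]) (R'' := [2, 7, 10, 11, 13, 15, 18])).trans hF₄
  have hF' : Frame [] [11, 12, 15, 16, 17, 18] s₁ s₄ :=
    (hF₂.trans hF₃ (A'' := []) (R'' := [11, 15, 18])).trans hF₄
  have hready : Ready N W b p ((1 + 1 / (p : ℝ)) ^ (Q - 1)) Q s₄ := by
    constructor
    · rw [hF.nat 0 (by decide)]
      simp [initMem, entry]
    · rw [hF.nat 0 (by decide)]
      simp [initMem, entry]
    · rw [hF.nat 0 (by decide)]
      simp [initMem, entry]
    · intro e
      rw [hF.nat 1 (by decide)]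
      simp [initMem, entry]
    · intro j m
      rw [hF.nat 4 (by decide)]
      simp only [initMem, entry_fin]
    · rwa [hF'.nat 5 (by decide)]
    · rwa [hF'.nat 6 (by decide)]
    · rwa [hF'.real 2 (by decide)]
    · rw [hF₄.real 11 (by decide), hF₃.real 11 (by decide), hp₂]
    · exact hR₄
    · exact hQ₄
  have hy₄ : ∀ e : Fin N.numE, s₄.real 7 0 e = 1 := by rwa [hF'.real 7 (by decide)]
  have hY₄ : s₄.real 13 0 0 = 1 := by rwa [hF'.real 13 (by decide)]
  have hf₄ : s₄.real 14 0 0 = 0 := by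
    rw [hF.real 14 (by decide)]
    rfl
  have hb0 : ∀ m, 0 ≤ b m := fun m => div_nonneg (hq m) hZ0.le
  have hb1 : ∀ m, b m ≤ 1 := fun m => (div_le_one hZ0).2 (hqZ m)
  have hpack : N.Packs F (fun m => lam * Z * b m) (fun e => N.cap e) := by
    refine ((CapNetwork.mem_semiRegion_iff hN hd).1 hgreat.1).2.mono (fun m => le_of_eq ?_)
      fun _ => le_rfl
    simp only [b, Pi.smul_apply, smul_eq_mul]
    field_simp
  refine Runs.seq (Runs.loop (c := .realLt (.var 13) (.var 12))
    (MainInvariant N F W b p Q B (lam * Z)) (Q * N.numE) (by positivity)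
    (fun i s h ht => ⟨?_, runs_roundCmd hN hd hcover hcode hT hinj hW hsurj hb0 hb1
      ⟨m₀, div_pos hm₀ hZ0⟩ hp0 hQ0 hB.le (mul_pos hlam hZ0) hpack h ht⟩) ?_)
    fun s₅ ⟨⟨i, _, hI⟩, ht⟩ => (Runs.fillR (b := msgCount) N.numM
      (entry fun m => s₅.real 14 0 0 / Q * b m) (fun s' hF => (hI.ready.frame hF).numM)
      fun j hj s' hF hc _ => ?_).mono le_rfl fun s₆ ⟨_, hv₆⟩ => ?_
  -- While the test succeeds all weights are below `(1 + ε) ^ (Q - 1)`, so the product bound leaves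
  -- room for one more round.
  · have h1 : i ≤ (Q - 1) * N.numE := by
      refine h.packing.lt hε fun e => (h.le_max e).trans_lt ?_
      rw [← h.ready.thr]
      exact ht
    refine h1.trans_lt (Nat.mul_lt_mul_of_pos_right (by omega) hE)
  · refine ⟨hready, ?_, fun e => ?_, fun e => ?_, ⟨⟨0, hE⟩, ?_⟩⟩
    · simp only [hf₄, hy₄]
      exact .zero
    · rw [hy₄]
      exact one_le_pow₀ (by linarith)
    · rw [hy₄, hY₄]
    · rw [hy₄, hY₄]
  · have hr := hI.ready.frame hF
    simp only [RExp.eval, NExp.eval]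
    rw [hc, hF.real 14 (by decide), hr.den, hr.demand ⟨j, hj⟩, entry_of_lt _ hj]
  · have hfin := hI.packing.final (F := F) hN hb0 (p := p) (g := g) hω hω1 hpω hg0 hgE
      (mul_pos hlam hZ0) (fun x hx => ?_) (hQ ▸ hI.le_pow) ?_
    · refine ⟨s₅.real 14 0 0 / Q / Z, ?_, ?_, ?_⟩
      · funext m
        refine (hv₆ m m.2).trans ?_
        rw [entry_fin]
        simp only [b, Pi.smul_apply, smul_eq_mul]
        ring
      · rw [div_le_iff₀ hZ0, hQ]
        push_cast
        exact hfin.1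
      · rw [← mul_div_assoc, le_div_iff₀ hZ0, hQ]
        push_cast
        exact hfin.2
    · have : x / Z ≤ lam := by
        refine hgreat.2 ?_
        have : (x / Z) • q = x • b := by
          funext m
          simp only [b, Pi.smul_apply, smul_eq_mul]
          ring
        rw [Set.mem_ofPred_eq, this]
        exact hx
      rwa [div_le_iff₀ hZ0] at this
    · obtain ⟨e, he⟩ := hI.max_eq
      refine ⟨e, ?_⟩
      rw [he, ← hQ, ← hI.ready.thr]
      exact not_lt.1 ht

/-! ### The running time -/

/-- Both the logarithm rounded down and the 1 for rounding up cost at most `log (n + 1) / log 2`,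
and `2 / log 2 < 3`. -/
theorem clog_le {n : ℕ} (hn : 0 < n) : ((max 1 (Nat.clog 2 n) : ℕ) : ℝ) ≤ 3 * Real.log (n + 1) := by
  have hn' : (1 : ℝ) ≤ n := by exact_mod_cast hn
  have h2 : Real.log 2 ≤ Real.log (n + 1) := Real.log_le_log two_pos (by linarith)
  have hl2 := Real.log_two_gt_d9
  by_cases hc : Nat.clog 2 n ≤ 1
  · rw [max_eq_left hc, Nat.cast_one]
    linarith
  · rw [max_eq_right (by omega)]
    have hn1 : 1 < n := by
      by_contra h
      obtain rfl : n = 1 := by omega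
      simp at hc
    have h1 := Nat.pow_pred_clog_lt_self one_lt_two hn1
    obtain ⟨c, hc'⟩ : ∃ c, Nat.clog 2 n = c + 1 := ⟨Nat.clog 2 n - 1, by omega⟩
    rw [hc'] at h1 ⊢
    have h3 : (2 : ℝ) ^ c ≤ n + 1 := by
      have : ((2 ^ c : ℕ) : ℝ) ≤ n := by exact_mod_cast h1.le
      push_cast at this
      linarith
    have h4 := Real.log_le_log (by positivity) h3
    rw [Real.log_pow] at h4
    push_cast
    have hc0 : (0 : ℝ) ≤ c := Nat.cast_nonneg c
    nlinarith

/-- The arithmetic of the running time. -/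
theorem time_le {E M K p g Q : ℕ} {Tc Ts ω B : ℝ} (hE : 0 < E) (hM : 0 < M) (hK : 0 < K)
    (hω : 0 < ω) (hω1 : ω ≤ 1) (hB : 1 ≤ B) (hTc : (M * K + M + 2 * K : ℝ) ≤ Tc)
    (hTs : (M + E : ℝ) ≤ Ts) (hp : p = ⌈5 / ω⌉₊) (hg : g = max 1 (Nat.clog 2 E))
    (hQ : Q = p * p * g) :
    (11 * M + 3 * K + 3 * (M * K) + 3 * E + 12 : ℝ) + ((2 * p + 2) + ((3 * g + 3) +
      ((3 * Q + 4) + (((Q * E : ℕ) * (3 * (K * M) + K * Ts + 9 * (K * E) +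
      11 * K + 19 * E + 15 + Tc + 1) + 1) + (M * 3 + 2))))) ≤
      30000 * (ω⁻¹ ^ 2 * (Real.log M + E) * B * Real.log (E + 1) * (Tc + K * Ts)) := by
  have hE1 : (1 : ℝ) ≤ E := by exact_mod_cast hE
  have hM1 : (1 : ℝ) ≤ M := by exact_mod_cast hM
  have hK1 : (1 : ℝ) ≤ K := by exact_mod_cast hK
  have hp1 : 1 ≤ p := by
    rw [hp]
    exact Nat.one_le_ceil_iff.2 (by positivity)
  have hg1 : 1 ≤ g := hg ▸ le_max_left _ _
  have hpQ : p ≤ Q := by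
    rw [hQ]
    nlinarith [Nat.mul_pos hp1 hg1]
  have hgQ : g ≤ Q := by
    rw [hQ]
    exact Nat.le_mul_of_pos_left _ (Nat.mul_pos hp1 hp1)
  have hpQ' : (p : ℝ) ≤ Q := by exact_mod_cast hpQ
  have hgQ' : (g : ℝ) ≤ Q := by exact_mod_cast hgQ
  have hQ1 : (1 : ℝ) ≤ Q := by exact_mod_cast hg1.trans hgQ
  set X := Tc + K * Ts with hX
  have hKT : (K * M + K * E : ℝ) ≤ K * Ts := by nlinarith
  have hKM : (M : ℝ) ≤ K * M := le_mul_of_one_le_left (by linarith) hK1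
  have hKM' : (K : ℝ) ≤ K * M := le_mul_of_one_le_right (by linarith) hM1
  have hKE : (E : ℝ) ≤ K * E := le_mul_of_one_le_left (by linarith) hK1
  have hcomm : (M * K : ℝ) = K * M := mul_comm _ _
  -- All work outside the oracles is linear in the query sizes, so the lower bounds on the oracle
  -- times absorb it.
  have hround : 3 * (K * M : ℝ) + K * Ts + 9 * (K * E) + 11 * K + 19 * E + 15 + Tc + 1 ≤
      60 * X := by
    linarith
  have hX1 : 1 ≤ X := by linarith
  have hQE : (1 : ℝ) ≤ Q * E := by nlinarith
  have hQE' : (Q : ℝ) ≤ Q * E := le_mul_of_one_le_right (by linarith) hE1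
  have htot : (11 * M + 3 * K + 3 * (M * K) + 3 * E + 12 : ℝ) + ((2 * p + 2) + ((3 * g + 3) +
      ((3 * Q + 4) + (((Q * E : ℕ) * (3 * (K * M) + K * Ts + 9 * (K * E) +
      11 * K + 19 * E + 15 + Tc + 1) + 1) + (M * 3 + 2))))) ≤ 150 * (Q * E * X) := by
    have h1 : (Q * E : ℝ) * (3 * (K * M) + K * Ts + 9 * (K * E) + 11 * K + 19 * E + 15 + Tc + 1) ≤
        Q * E * (60 * X) := mul_le_mul_of_nonneg_left hround (by linarith)
    have h2 : X ≤ Q * E * X := le_mul_of_one_le_left (by linarith) hQE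
    have h3 : (Q * E : ℝ) ≤ Q * E * X := le_mul_of_one_le_right (by linarith) hX1
    push_cast
    linarith
  refine htot.trans ?_
  have hpω : (p : ℝ) ≤ 6 * ω⁻¹ := by
    have h1 := Nat.ceil_lt_add_one (a := 5 / ω) (by positivity)
    have h2 : 1 ≤ ω⁻¹ := (one_le_inv₀ hω).2 hω1
    rw [hp]
    rw [div_eq_mul_inv] at h1 ⊢
    linarith
  have hgl : (g : ℝ) ≤ 3 * Real.log (E + 1) := by
    rw [hg]
    exact clog_le hE
  have hlog : 0 ≤ Real.log (E + 1) := Real.log_nonneg (by linarith)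
  -- The constant is `6 * 6 * 3`, from `p ≤ 6 / ω` twice and `g ≤ 3 * log (E + 1)`.
  have hQle : (Q : ℝ) ≤ 108 * (ω⁻¹ ^ 2 * Real.log (E + 1)) := by
    have : (Q : ℝ) = p * p * g := by simp [hQ]
    rw [this]
    calc (p * p * g : ℝ) ≤ (6 * ω⁻¹) * (6 * ω⁻¹) * (3 * Real.log (E + 1)) := by gcongr
      _ = _ := by ring
  -- The number of rounds is bounded by `Q * E`; `log M` and `B` enter the final bound only as
  -- slack.
  have hEB : (E : ℝ) ≤ (Real.log M + E) * B := by
    have := Real.log_nonneg hM1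
    nlinarith
  calc 150 * (Q * E * X) ≤ 150 * (108 * (ω⁻¹ ^ 2 * Real.log (E + 1)) *
        ((Real.log M + E) * B) * X) := by gcongr
    _ = 16200 * (ω⁻¹ ^ 2 * (Real.log M + E) * B * Real.log (E + 1) * X) := by ring
    _ ≤ _ := by
      have h0 : 0 ≤ Real.log M + E := by
        have := Real.log_nonneg hM1
        linarith
      gcongr
      norm_num

end OracleRAM

/-! ### Assembly of the theorem -/

theorem smul_mem_segment_smul {E : Type*} [AddCommGroup E] [Module ℝ E] {a c lam : ℝ} (v : E)
    (h1 : c ≤ lam) (h2 : lam ≤ a * c) : lam • v ∈ segment ℝ (c • v) (a • c • v) := by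
  have h : lam ∈ segment ℝ c (a * c) := by
    rw [segment_eq_Icc (h1.trans h2)]
    exact ⟨h1, h2⟩
  obtain ⟨x, y, hx, hy, hxy, h⟩ := h
  refine ⟨x, y, hx, hy, hxy, ?_⟩
  rw [← h]
  simp only [smul_smul, smul_eq_mul, add_smul]

theorem theorem5 :
    ∃ (prog : OracleRAM.Cmd) (K : ℝ),
      ∀ (F : Type*) [Field F] [Finite F] (N : CapNetwork),
        Nat.card N.Alph ≤ Nat.card F → N.Nondegenerate → (∀ m, ∃ x, m ∈ N.rcv x) →
      ∀ (W : Fin (N.numWeights F) ≃ {w // N.IsWeightVector F w})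
        (B ω : ℝ), 1 ≤ B → 0 < ω → ω ≤ 1 →
      ∀ (O : OracleRAM.Oracles N.numE N.numM (N.numWeights F)),
        CoverInstance.IsApproxOracle B O.cover → N.IsExactCodeOracle F O.code →
        -- a call takes at least the time to write the query down
        (N.numM * N.numWeights F + N.numM + 2 * N.numWeights F : ℝ) ≤ O.coverTime →
        (N.numM + N.numE : ℝ) ≤ O.codeTime →
      ∀ (q : Fin N.numM → ℝ), (∀ i, 0 ≤ q i) → q ≠ 0 →
      ∃ (time : ℝ) (s : OracleRAM.Mem),
        OracleRAM.Exec O prog (OracleRAM.initMem N (fun j => (W j).1) ω B q) time s ∧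
        (∃ lam : ℝ, IsGreatest {x : ℝ | x • q ∈ N.semiRegion F} lam ∧
          lam • q ∈ segment ℝ (OracleRAM.output N.numM s)
            (((1 + ω) * B) • OracleRAM.output N.numM s)) ∧
        time ≤ K * (ω⁻¹ ^ 2 * (Real.log N.numM + N.numE) * B * Real.log (N.numE + 1) *
          (O.coverTime + N.numWeights F * O.codeTime)) := by
  refine ⟨OracleRAM.rayCmd, 30000, ?_⟩
  intro F _ _ N _ hN hd W B ω hB hω hω1 O hcover hcode hTc hTs q hq hq0
  obtain ⟨lam, hlam, hgreat⟩ := CapNetwork.exists_isGreatest_ray (F := F) hN hd hq hq0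
  have hsurj : ∀ w, N.IsWeightVector F w → ∃ j, (W j).1 = w := fun w hw =>
    ⟨W.symm ⟨w, hw⟩, by simp⟩
  -- A nonzero direction supplies a message; routing it supplies an edge and a weight vector, so
  -- none of the three counts is 0.
  obtain ⟨m, -⟩ := Function.ne_iff.1 hq0
  obtain ⟨U, hU⟩ := CapNetwork.exists_solvable_single N F hN m
  obtain ⟨e, -⟩ := hU.nonempty hN hd (m := m) (by simp)
  obtain ⟨P, hP, -⟩ := hU
  obtain ⟨j, -⟩ := hsurj _ ⟨P, hP⟩
  obtain ⟨time, s, hexec, htime, c, hout, hc, hc'⟩ := OracleRAM.runs_rayCmd (F := F)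
    (W := fun j => (W j).1) hN hd hcover hcode
    (le_trans (by positivity) hTs) (le_trans (by positivity) hTc)
    (Subtype.val_injective.comp W.injective) (fun j => (W j).2) hsurj e.pos (by linarith) hω hω1 hq
    hq0 hlam hgreat rfl rfl rfl
  refine ⟨time, s, hexec, ⟨lam, hgreat, ?_⟩, htime.trans
    (OracleRAM.time_le e.pos m.pos j.pos hω hω1 hB hTc hTs rfl rfl rfl)⟩
  rw [hout]
  exact smul_mem_segment_smul q hc hc'
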